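/- Let $n\ge 1$, and consider super forms on $\mathbb R^n_x\times\mathbb R^n_\xi$, i.e. smooth forms $\alpha=\sum_{K,L}\alpha_{KL}(x)\,dx_K\wedge d\xi_L$ whose coefficients depend only on $x$; $\alpha$ has bidegree $(p,q)$ if $|K|=p$, $|L|=q$ throughout. Let $J$ be the pull-back by $(x,\xi)\mapsto(\xi,x)$ at the level of covectors (so $J(dx_i)=d\xi_i$, $J(d\xi_i)=dx_i$, coefficients unchanged), $d\alpha=\sum_i dx_i\wedge\partial_{x_i}\alpha$ and $d^\#=J\circ d\circ J$. A current of bidegree $(p,q)$ is a continuous linear functional on the compactly supported smooth super forms of bidegree $(n-p,n-q)$. For a current $T$ of total degree $r$ put $\langle dT,\alpha\rangle=(-1)^{r+1}\langle T,d\alpha\rangle$, $\langle d^\#T,\alpha\rangle=(-1)^{r+1}\langle T,d^\#\alpha\rangle$, and for a constant $(0,1)$-form $\theta$ put $\langle T\wedge\theta,\alpha\rangle=\langle T,\theta\wedge\alpha\rangle$. A continuous function $f$ on $\mathbb R^n$ is the $(0,0)$-current $\langle f,\alpha_0\,dx_1\wedge\dots\wedge dx_n\wedge d\xi_1\wedge\dots\wedge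 d\xi_n\rangle=\int_{\mathbb R^n} f\alpha_0\,dx$. Let $A\subset\mathbb Z^n$ be finite and non-empty, let $\nu:A\to\mathbb R$, and let $f(x)=\max_{a\in A}(-\nu(a)+a\cdot x)$ be the associated tropical polynomial, with tropical hypersurface $V_f=\{x: f\text{ is not smooth at }x\}$. For $a\in A$ let $C_a$ be the set where $-\nu(a)+a\cdot x=f(x)$. The facets of $V_f$ are the sets $V_f\cap C_a\cap C_b$ of dimension $n-1$, where $a\neq b$ are elements of $A$ such that $C_a$ and $C_b$ have non-empty interior; its normal vector is $v=a-b$ or $v=b-a$ (either choice is allowed). Let $V_1,\dots,V_s$ be the facets of $V_f$, each listed once, with normal vectors $v_1,\dots,v_s$, and put $v_i^*=d(v_i\cdot x)$. Orient $V_i$ by $v_i$: a basis $(e_1,\dots,e_{n-1})$ of the direction of $V_i$ is positive if $(v_i,e_1,\dots,e_{n-1})$ is a positive basis of $\mathbb R^n$. Let $[V_i]$ be the current of integration on $V_i$, that is, the $(1,0)$-current $$\Big\langle[V_i],\ \sum_{|I|=n-1}\alpha_I\,dx_I\wedge d\xi_1\wedge\dots\wedge d\xi_n\Big\rangle=\sum_{|I|=n-1}\int_{V_i}\alpha_I\,dx_I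 .$$ Then, as currents of bidegree $(1,1)$, $$dd^\# f=\sum_{i=1}^s [V_i]\wedge J(v_i^*).$$ -/

import Mathlib

open scoped ContDiff Distributions MeasureTheory

noncomputable section

/-! Super forms and super currents on `ℝⁿ × ℝⁿ`. -/

/-- The factor `ℝⁿ` (with its standard inner product); super forms live on `ℝⁿ × ℝⁿ`, with
coordinates `(x, ξ)`. -/
abbrev RSpace (n : ℕ) : Type := EuclideanSpace ℝ (Fin n)

/-- The isomorphism `J (x, ξ) = (ξ, x)`. -/
def swapJ (n : ℕ) : (RSpace n × RSpace n) →L[ℝ] (RSpace n × RSpace n) :=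
  (ContinuousLinearMap.snd ℝ (RSpace n) (RSpace n)).prod
    (ContinuousLinearMap.fst ℝ (RSpace n) (RSpace n))

/-- The alternating `k`-forms on `ℝⁿ × ℝⁿ` of bidegree `(p, q)`, i.e. the combinations of the
`dx_K ∧ dξ_L` with `|K| = p`, `|L| = q`: those which vanish on every family of vectors, each taken
from one of the two factors, unless exactly `p` are taken from the first factor and `q` from the
second.  (This is the zero space unless `k = p + q`.) -/
def bidegree (n k p q : ℕ) :
    Submodule ℝ ((RSpace n × RSpace n) [⋀^Fin k]→L[ℝ] ℝ) where
  carrier := {α | ∀ (w : Fin k → RSpace n × RSpace n) (S : Finset (Fin k)),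
    (∀ i ∈ S, (w i).2 = 0) → (∀ i ∉ S, (w i).1 = 0) → ¬(S.card = p ∧ Sᶜ.card = q) → α w = 0}
  add_mem' := by
    intro α β hα hβ w S h1 h2 h3
    simp [hα w S h1 h2 h3, hβ w S h1 h2 h3]
  zero_mem' := by
    intro w S _ _ _
    rfl
  smul_mem' := by
    intro c α hα w S h1 h2 h3
    simp [hα w S h1 h2 h3]

/-- The space of alternating forms of bidegree `(p, q)`, as a normed space. -/
def BiForm (n k p q : ℕ) : Type := bidegree n k p q

instance (n k p q : ℕ) : NormedAddCommGroup (BiForm n k p q) :=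
  inferInstanceAs (NormedAddCommGroup (bidegree n k p q))

instance (n k p q : ℕ) : NormedSpace ℝ (BiForm n k p q) :=
  inferInstanceAs (NormedSpace ℝ (bidegree n k p q))

/-- The inclusion of the forms of bidegree `(p, q)` into all alternating forms. -/
def BiForm.incl (n k p q : ℕ) :
    BiForm n k p q →L[ℝ] (RSpace n × RSpace n) [⋀^Fin k]→L[ℝ] ℝ :=
  Submodule.subtypeL (bidegree n k p q)

lemma BiForm.incl_mem {n k p q : ℕ} (α : BiForm n k p q) :
    BiForm.incl n k p q α ∈ bidegree n k p q := Subtype.property α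

/-- A map into the alternating forms, all of whose values have bidegree `(p, q)`. -/
def BiForm.lift {n k p q : ℕ} {F : Type*} [NormedAddCommGroup F] [NormedSpace ℝ F]
    (T : F →L[ℝ] (RSpace n × RSpace n) [⋀^Fin k]→L[ℝ] ℝ) (hT : ∀ y, T y ∈ bidegree n k p q) :
    F →L[ℝ] BiForm n k p q :=
  ContinuousLinearMap.codRestrict T (bidegree n k p q) hT

/-- The space `𝒟^{p,q}` of compactly supported smooth super forms
`∑ α_{KL}(x) dx_K ∧ dξ_L` of bidegree `(p, q)` (`k = p + q` is the total degree); the coefficients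
depend on `x` only.  It carries the usual topology of a space of test functions. -/
abbrev TestForm (n k p q : ℕ) : Type :=
  TestFunction (⊤ : TopologicalSpace.Opens (RSpace n)) (BiForm n k p q) ⊤

/-- The topological dual of `𝒟^{p,q}`, that is, the space `𝒟_{n-p,n-q}` of super currents of
bidegree `(n - p, n - q)`. -/
abbrev SuperCurrent (n k p q : ℕ) : Type := TestForm n k p q →L[ℝ] ℝ

/-! ### The operators `J`, `d`, `d^#` and the wedge product with a `1`-form -/

lemma swapJ_mem_bidegree {n k p q : ℕ} {α : (RSpace n × RSpace n) [⋀^Fin k]→L[ℝ] ℝ}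
    (hα : α ∈ bidegree n k p q) :
    α.compContinuousLinearMap (swapJ n) ∈ bidegree n k q p := by
  intro w S h1 h2 h3
  refine hα _ Sᶜ ?_ ?_ ?_
  · intro i hi
    exact h2 i (by simpa using hi)
  · intro i hi
    exact h1 i (by simpa using hi)
  · rw [compl_compl]
    exact fun h => h3 ⟨h.2, h.1⟩

/-- `J` on forms at a point: the pull-back by `J`, so that `J (dx_i) = dξ_i`, `J (dξ_i) = dx_i`. -/
def jPoint (n k p q : ℕ) : BiForm n k p q →L[ℝ] BiForm n k q p :=
  BiForm.lift ((ContinuousAlternatingMap.compContinuousLinearMapCLM (swapJ n)).comp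
    (BiForm.incl n k p q)) (fun α => swapJ_mem_bidegree (BiForm.incl_mem α))

/-- `J : 𝒟^{p,q} → 𝒟^{q,p}`. -/
def formJ (n k p q : ℕ) : TestForm n k p q →L[ℝ] TestForm n k q p :=
  TestFunction.postcompCLM (jPoint n k p q)

lemma card_preimage_succAbove {k : ℕ} (S : Finset (Fin (k + 1))) (i : Fin (k + 1)) :
    (Finset.univ.filter (fun j : Fin k => i.succAbove j ∈ S)).card = (S.erase i).card := by
  rw [← Finset.card_map (Fin.succAboveEmb i)]
  congr 1
  ext j
  simp only [Finset.mem_map, Finset.mem_filter, Finset.mem_univ, true_and, Finset.mem_erase]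
  constructor
  · rintro ⟨l, hl, rfl⟩
    exact ⟨Fin.succAbove_ne i l, hl⟩
  · rintro ⟨hne, hj⟩
    obtain ⟨l, rfl⟩ := Fin.exists_succAbove_eq hne
    exact ⟨l, hj, rfl⟩

lemma alternatize_mem_bidegree_left {n k p q : ℕ}
    (g : (RSpace n × RSpace n) →L[ℝ] (RSpace n × RSpace n) [⋀^Fin k]→L[ℝ] ℝ)
    (hg : ∀ w, g w ∈ bidegree n k p q) (h0 : ∀ ξ, g (0, ξ) = 0) :
    ContinuousAlternatingMap.alternatizeUncurryFin g ∈ bidegree n (k + 1) (p + 1) q := by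
  intro w S h1 h2 h3
  rw [ContinuousAlternatingMap.alternatizeUncurryFin_apply]
  refine Finset.sum_eq_zero fun i _ => ?_
  by_cases hi : i ∈ S
  · have : g (w i) (i.removeNth w) = 0 := by
      refine hg (w i) _ (Finset.univ.filter (fun j : Fin k => i.succAbove j ∈ S)) ?_ ?_ ?_
      · intro j hj
        exact h1 _ (by simpa using hj)
      · intro j hj
        exact h2 _ (by simpa using hj)
      · rintro ⟨hp, hq⟩
        rw [card_preimage_succAbove, Finset.card_erase_of_mem hi] at hp
        have hc : (Finset.univ.filter (fun j : Fin k => i.succAbove j ∈ S))ᶜ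
            = Finset.univ.filter (fun j : Fin k => i.succAbove j ∈ Sᶜ) := by
          ext j; simp
        rw [hc, card_preimage_succAbove, Finset.erase_eq_of_notMem (by simpa using hi)] at hq
        have := Finset.card_pos.2 ⟨i, hi⟩
        exact h3 ⟨by omega, hq⟩
    rw [this, smul_zero]
  · have hw : w i = (0, (w i).2) := Prod.ext (h2 i hi) rfl
    rw [hw, h0]
    simp

lemma alternatize_mem_bidegree_right {n k p q : ℕ}
    (g : (RSpace n × RSpace n) →L[ℝ] (RSpace n × RSpace n) [⋀^Fin k]→L[ℝ] ℝ)
    (hg : ∀ w, g w ∈ bidegree n k p q) (h0 : ∀ x, g (x, 0) = 0) :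
    ContinuousAlternatingMap.alternatizeUncurryFin g ∈ bidegree n (k + 1) p (q + 1) := by
  intro w S h1 h2 h3
  rw [ContinuousAlternatingMap.alternatizeUncurryFin_apply]
  refine Finset.sum_eq_zero fun i _ => ?_
  by_cases hi : i ∈ S
  · have hw : w i = ((w i).1, 0) := Prod.ext rfl (h1 i hi)
    rw [hw, h0]
    simp
  · have : g (w i) (i.removeNth w) = 0 := by
      refine hg (w i) _ (Finset.univ.filter (fun j : Fin k => i.succAbove j ∈ S)) ?_ ?_ ?_
      · intro j hj
        exact h1 _ (by simpa using hj)
      · intro j hj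
        exact h2 _ (by simpa using hj)
      · rintro ⟨hp, hq⟩
        rw [card_preimage_succAbove, Finset.erase_eq_of_notMem hi] at hp
        have hc : (Finset.univ.filter (fun j : Fin k => i.succAbove j ∈ S))ᶜ
            = Finset.univ.filter (fun j : Fin k => i.succAbove j ∈ Sᶜ) := by
          ext j; simp
        have hi' : i ∈ Sᶜ := by simpa using hi
        rw [hc, card_preimage_succAbove, Finset.card_erase_of_mem hi'] at hq
        have := Finset.card_pos.2 ⟨i, hi'⟩
        exact h3 ⟨hp, by omega⟩
    rw [this, smul_zero]

/-- The pointwise part of `d`: a differential `x ↦ ∑ᵢ xᵢ ∂ᵢα` of a form is sent to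
`∑ᵢ dxᵢ ∧ ∂ᵢα`. -/
def dPoint (n k p q : ℕ) :
    (RSpace n →L[ℝ] BiForm n k p q) →L[ℝ] BiForm n (k + 1) (p + 1) q :=
  BiForm.lift
    (((ContinuousAlternatingMap.alternatizeUncurryFinCLM ℝ (RSpace n × RSpace n) ℝ).comp
      (ContinuousLinearMap.compL ℝ (RSpace n × RSpace n) (BiForm n k p q)
        ((RSpace n × RSpace n) [⋀^Fin k]→L[ℝ] ℝ) (BiForm.incl n k p q))).comp
      ((ContinuousLinearMap.compL ℝ (RSpace n × RSpace n) (RSpace n) (BiForm n k p q)).flip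
        (ContinuousLinearMap.fst ℝ (RSpace n) (RSpace n))))
    (fun g => alternatize_mem_bidegree_left
      ((BiForm.incl n k p q).comp (g.comp (ContinuousLinearMap.fst ℝ (RSpace n) (RSpace n))))
      (fun w => BiForm.incl_mem (g w.1)) (fun ξ => by simp))

/-- `d : 𝒟^{p,q} → 𝒟^{p+1,q}`, `d (α_{KL} dx_K ∧ dξ_L) = ∑ᵢ ∂ᵢα_{KL} dxᵢ ∧ dx_K ∧ dξ_L`. -/
def formD (n k p q : ℕ) : TestForm n k p q →L[ℝ] TestForm n (k + 1) (p + 1) q :=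
  (TestFunction.postcompCLM (dPoint n k p q)).comp (TestFunction.fderivCLM ℝ ⊤ ⊤)

/-- `formD` is the usual exterior derivative on `ℝⁿ × ℝⁿ`. -/
lemma formD_eq_extDeriv {n k p q : ℕ} (α : TestForm n k p q) (x ξ : RSpace n) :
    BiForm.incl n (k + 1) (p + 1) q (formD n k p q α x) =
      extDeriv (fun w : RSpace n × RSpace n => BiForm.incl n k p q (α w.1)) (x, ξ) := by
  have hα : HasFDerivAt (α : RSpace n → BiForm n k p q) (fderiv ℝ α x) x :=
    (α.contDiff.differentiable (by simp)).differentiableAt.hasFDerivAt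
  have h1 : HasFDerivAt (fun w : RSpace n × RSpace n => α w.1)
      ((fderiv ℝ α x).comp (ContinuousLinearMap.fst ℝ (RSpace n) (RSpace n))) (x, ξ) :=
    HasFDerivAt.comp (x, ξ) (f := Prod.fst) (g := α) hα hasFDerivAt_fst
  have h2 : HasFDerivAt (fun w : RSpace n × RSpace n => BiForm.incl n k p q (α w.1))
      ((BiForm.incl n k p q).comp
        ((fderiv ℝ α x).comp (ContinuousLinearMap.fst ℝ (RSpace n) (RSpace n)))) (x, ξ) :=
    (BiForm.incl n k p q).hasFDerivAt.comp (x, ξ) h1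
  rw [extDeriv, h2.fderiv]
  simp only [formD, ContinuousLinearMap.comp_apply, TestFunction.postcompCLM_apply,
    Function.comp_apply, TestFunction.fderivCLM_apply]
  rfl

/-- `d^# = J ∘ d ∘ J : 𝒟^{p,q} → 𝒟^{p,q+1}`. -/
def formDSharp (n k p q : ℕ) : TestForm n k p q →L[ℝ] TestForm n (k + 1) p (q + 1) :=
  (formJ n (k + 1) (q + 1) p).comp ((formD n k q p).comp (formJ n k p q))

/-- The pointwise wedge product `α ↦ θ ∧ α` with a constant form `θ` of bidegree `(0, 1)`. -/
def wedgePoint (n k p q : ℕ) (θ : (RSpace n × RSpace n) →L[ℝ] ℝ) (hθ : ∀ x, θ (x, 0) = 0) :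
    BiForm n k p q →L[ℝ] BiForm n (k + 1) p (q + 1) :=
  BiForm.lift
    (((ContinuousAlternatingMap.alternatizeUncurryFinCLM ℝ (RSpace n × RSpace n) ℝ).comp
      (ContinuousLinearMap.smulRightL ℝ (RSpace n × RSpace n)
        ((RSpace n × RSpace n) [⋀^Fin k]→L[ℝ] ℝ) θ)).comp (BiForm.incl n k p q))
    (fun α => alternatize_mem_bidegree_right (θ.smulRight (BiForm.incl n k p q α))
      (fun w => (bidegree n k p q).smul_mem _ (BiForm.incl_mem α)) (fun x => by simp [hθ]))

namespace SuperCurrent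

/-- The exterior derivative of a current, `⟨dT, α⟩ = (-1)^(deg T + 1) ⟨T, dα⟩`.  Here `T` acts on
forms of degree `k + 1`, so `deg T = 2n - (k + 1)` and the sign is `(-1)^k`. -/
def d {n k p q : ℕ} (T : SuperCurrent n (k + 1) (p + 1) q) : SuperCurrent n k p q :=
  ((-1 : ℝ) ^ k) • T.comp (formD n k p q)

/-- The operator `d^#` on currents, `⟨d^#T, α⟩ = (-1)^(deg T + 1) ⟨T, d^#α⟩`. -/
def dSharp {n k p q : ℕ} (T : SuperCurrent n (k + 1) p (q + 1)) : SuperCurrent n k p q :=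
  ((-1 : ℝ) ^ k) • T.comp (formDSharp n k p q)

/-- The wedge product `⟨T ∧ θ, α⟩ = ⟨T, θ ∧ α⟩` of a current with a constant form `θ` of bidegree
`(0, 1)`. -/
def wedge {n k p q : ℕ} (T : SuperCurrent n (k + 1) p (q + 1))
    (θ : (RSpace n × RSpace n) →L[ℝ] ℝ) (hθ : ∀ x, θ (x, 0) = 0) : SuperCurrent n k p q :=
  T.comp (TestFunction.postcompCLM (wedgePoint n k p q θ hθ))

end SuperCurrent

/-! ### Integration of super forms -/

/-- The family `(e₁, 0), …, (e_r, 0), (0, ε₁), …, (0, ε_s)` of vectors of `ℝⁿ × ℝⁿ`. -/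
def superFrame {n r s k : ℕ} (h : k = r + s) (e : Fin r → RSpace n) (ε : Fin s → RSpace n) :
    Fin k → RSpace n × RSpace n := fun i =>
  Fin.append (fun j => (e j, (0 : RSpace n))) (fun j => ((0 : RSpace n), ε j)) (Fin.cast h i)

/-- Evaluation of a test form on a fixed family of vectors, a scalar test function. -/
def evalFrame {n k p q : ℕ} (w : Fin k → RSpace n × RSpace n) :
    TestForm n k p q →L[ℝ] TestFunction (⊤ : TopologicalSpace.Opens (RSpace n)) ℝ ⊤ :=
  TestFunction.postcompCLM
    ((ContinuousAlternatingMap.apply ℝ (RSpace n × RSpace n) ℝ w).comp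
      (BiForm.incl n k p q))

/-- The standard orthonormal basis of `ℝⁿ`. -/
def stdFrame (n : ℕ) : Fin n → RSpace n := fun i => EuclideanSpace.single i 1

/-- A (locally integrable) function `f` as a current of bidegree `(0, 0)`:
`⟨f, α₀ dx₁ ∧ … ∧ dxₙ ∧ dξ₁ ∧ … ∧ dξₙ⟩ = ∫ f α₀ dx₁ ⋯ dxₙ`. -/
def functionCurrent {n k : ℕ} (h : k = n + n) (f : RSpace n → ℝ) : SuperCurrent n k n n :=
  (TestFunction.integralAgainstBilinCLM (ContinuousLinearMap.mul ℝ ℝ)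
    MeasureTheory.volume f).comp (evalFrame (superFrame h (stdFrame n) (stdFrame n)))

/-- An orthonormal basis of the linear hyperplane orthogonal to `v ≠ 0` in `ℝ^(m+1)`. -/
def hyperplaneFrame {m : ℕ} (v : RSpace (m + 1)) (hv : v ≠ 0) : Fin m → RSpace (m + 1) :=
  haveI : Fact (Module.finrank ℝ (RSpace (m + 1)) = m + 1) := ⟨finrank_euclideanSpace_fin⟩
  fun i => (OrthonormalBasis.fromOrthogonalSpanSingleton (𝕜 := ℝ) m hv i : RSpace (m + 1))

/-- The sign of the basis `(v, e₁, …, e_m)` with respect to the standard orientation of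
`ℝ^(m+1)`. -/
def orientationSign {m : ℕ} (v : RSpace (m + 1)) (e : Fin m → RSpace (m + 1)) : ℝ :=
  SignType.sign ((EuclideanSpace.basisFun (Fin (m + 1)) ℝ).toBasis.det (Fin.cons v e))

/-- The current of integration `[V]`, where `V` is a piece of a hyperplane with normal vector `v`,
oriented by `v`: a basis `(e₁, …, e_m)` of the hyperplane is positive if `(v, e₁, …, e_m)` is a
positive basis of `ℝ^(m+1)`.  It is the `(1, 0)`-current
`⟨[V], ∑_I α_I dx_I ∧ dξ₁ ∧ … ∧ dξₙ⟩ = ∑_I ∫_V α_I dx_I`, the integral over the oriented `V` of an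
`m`-form `β` being the integral of `β(e₁, …, e_m)` against the surface measure for a positive
orthonormal basis (the negative of that integral for a negative orthonormal basis). -/
def integrationCurrent {m k : ℕ} (h : k = m + (m + 1)) (v : RSpace (m + 1)) (hv : v ≠ 0)
    (V : Set (RSpace (m + 1))) : SuperCurrent (m + 1) k m (m + 1) :=
  orientationSign v (hyperplaneFrame v hv) •
    (TestFunction.integralAgainstBilinCLM (ContinuousLinearMap.mul ℝ ℝ)
      ((MeasureTheory.Measure.euclideanHausdorffMeasure m).restrict V) (fun _ => (1 : ℝ))).comp
      (evalFrame (superFrame h (hyperplaneFrame v hv) (stdFrame (m + 1))))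

/-- The `1`-form `v^* = d(v · x)` on `ℝⁿ × ℝⁿ`. -/
def normalForm {n : ℕ} (v : RSpace n) : (RSpace n × RSpace n) →L[ℝ] ℝ :=
  (innerSL ℝ v).comp (ContinuousLinearMap.fst ℝ (RSpace n) (RSpace n))

/-- The `1`-form `J(v^*)`. -/
def normalFormJ {n : ℕ} (v : RSpace n) : (RSpace n × RSpace n) →L[ℝ] ℝ :=
  (normalForm v).comp (swapJ n)

lemma normalFormJ_left {n : ℕ} (v x : RSpace n) : normalFormJ v (x, 0) = 0 := by
  simp [normalFormJ, normalForm, swapJ]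

/-! ### Tropical polynomials -/

/-- An integer vector as an element of `ℝⁿ`. -/
def intVec {n : ℕ} (a : Fin n → ℤ) : RSpace n := WithLp.toLp 2 (fun i => (a i : ℝ))

/-- The affine function `-ν(a) + a · x`. -/
def tropMonomial {n : ℕ} (ν : (Fin n → ℤ) → ℝ) (a : Fin n → ℤ) (x : RSpace n) : ℝ :=
  -ν a + inner ℝ (intVec a) x

/-- The tropical polynomial `f(x) = max_{a ∈ A} (-ν(a) + a · x)`. -/
def tropPoly {n : ℕ} (A : Finset (Fin n → ℤ)) (hA : A.Nonempty) (ν : (Fin n → ℤ) → ℝ)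
    (x : RSpace n) : ℝ :=
  A.sup' hA (fun a => tropMonomial ν a x)

/-- The tropical hypersurface `V_f`: the set of points at which `f` is not smooth. -/
def tropHypersurface {n : ℕ} (A : Finset (Fin n → ℤ)) (hA : A.Nonempty) (ν : (Fin n → ℤ) → ℝ) :
    Set (RSpace n) :=
  {x | ¬ ContDiffAt ℝ ∞ (tropPoly A hA ν) x}

/-- The set where the monomial of exponent `a` realizes the maximum. -/
def tropCell {n : ℕ} (A : Finset (Fin n → ℤ)) (hA : A.Nonempty) (ν : (Fin n → ℤ) → ℝ)
    (a : Fin n → ℤ) : Set (RSpace n) :=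
  {x | tropMonomial ν a x = tropPoly A hA ν x}

/-- The part of `V_f` where the monomials of exponents `a` and `b` both realize the maximum. -/
def tropFacet {n : ℕ} (A : Finset (Fin n → ℤ)) (hA : A.Nonempty) (ν : (Fin n → ℤ) → ℝ)
    (a b : Fin n → ℤ) : Set (RSpace n) :=
  tropHypersurface A hA ν ∩ (tropCell A hA ν a ∩ tropCell A hA ν b)

/-- `a` and `b` are the exponents of the two monomials of `f` which compete for the maximum along an
`(n - 1)`-dimensional facet of `V_f`: the sets where they realize the maximum are
`n`-dimensional, and meet in a set of dimension `n - 1`. -/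
structure IsFacetPair {n : ℕ} (A : Finset (Fin n → ℤ)) (hA : A.Nonempty) (ν : (Fin n → ℤ) → ℝ)
    (a b : Fin n → ℤ) : Prop where
  left_mem : a ∈ A
  right_mem : b ∈ A
  ne : a ≠ b
  left_cell : (interior (tropCell A hA ν a)).Nonempty
  right_cell : (interior (tropCell A hA ν b)).Nonempty
  nonempty : (tropFacet A hA ν a b).Nonempty
  dim_eq : Module.finrank ℝ (vectorSpan ℝ (tropFacet A hA ν a b)) + 1 = n

/-- The normal vector `a - b` associated to a facet. -/
def facetNormal {n : ℕ} (a b : Fin n → ℤ) : RSpace n := intVec (a - b)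

lemma IsFacetPair.normal_ne_zero {n : ℕ} {A : Finset (Fin n → ℤ)} {hA : A.Nonempty}
    {ν : (Fin n → ℤ) → ℝ} {a b : Fin n → ℤ} (h : IsFacetPair A hA ν a b) :
    facetNormal a b ≠ 0 := by
  intro h0
  apply h.ne
  funext i
  have := congrArg (fun y : RSpace n => y i) h0
  simp [facetNormal, intVec] at this
  have h2 : (a i : ℝ) = (b i : ℝ) := by linarith
  exact_mod_cast h2

/-- The families `(a i, b i)` of exponents list the facets of `V_f`: each facet is listed exactly
once, with one of the two possible choices `± (a i - b i)` of its normal vector. -/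
structure IsFacetList {n : ℕ} {ι : Type*} (A : Finset (Fin n → ℤ)) (hA : A.Nonempty)
    (ν : (Fin n → ℤ) → ℝ) (a b : ι → Fin n → ℤ) : Prop where
  isFacetPair : ∀ i, IsFacetPair A hA ν (a i) (b i)
  existsUnique : ∀ c c', IsFacetPair A hA ν c c' →
    ∃! i, (a i = c ∧ b i = c') ∨ (a i = c' ∧ b i = c)

end

/-!
Paired with a test form `α` of bidegree `(m, m)`, both sides of the formula are combinations of the
coefficients `α_{ij}` of `dx_{≠ i} ∧ dξ_{≠ j}`, with `n = m + 1`.  On the left,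
`-∫ f d^# d α = (-1)^m ∑_{ij} (-1)^(i + j) ∫ f ∂_j ∂_i α_{ij}`.  On the right, a positive
orthonormal frame `E` of the hyperplane `v^⊥` satisfies
`β(E) = ∑_i (-1)^i v_i / ‖v‖ β(e_{≠ i})` for every `m`-form `β`
(`orientationSign_mul_apply_hyperplaneFrame`, from evaluating the top form `v^* ∧ β` on `(v, E)` and
on the standard frame), so that `[V] ∧ J(v^*)` integrates
`(-1)^m ∑_{ij} (-1)^(i + j) v_i v_j / ‖v‖ α_{ij}` over `V`.  The theorem thus says that the
distributional Hessian of `f` is `∑_V v vᵀ / ‖v‖` times the surface measure of `V`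
(`integral_tropPoly_mul_fderiv_fderiv`).

The Hessian of a maximum of affine functions `ℓ_a` with gradients `a` follows from the divergence
theorem on the open polyhedra `U_a` where `ℓ_a` is strictly largest
(`integral_max_affine_mul_fderiv_fderiv`).  Since `f = ℓ_a` on `U_a`, integrating by parts once
gives boundary terms which cancel in pairs by the continuity of `f`, and integrating by parts again
gives `∑_{(a, b)} ⟪a, u⟫ ⟪a - b, w⟫ / ‖a - b‖ ∫_{V_{ab}} φ`; the summand is antisymmetric in
`(a, b)` up to the factor `⟪a, u⟫`, which may therefore be replaced by half of `⟪a - b, u⟫`.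

The divergence theorem itself (`integral_fderiv_openPolyhedron`) is obtained by replacing the
indicator function of a polyhedron by a product of smooth steps of width `ε`, one for each
inequality.  The derivative of one step lives in a layer of width `ε` around a hyperplane;
stretching the normal coordinate by `ε`, its integral converges to a surface integral
(`tendsto_boundary_layer`).  The remaining steps converge to the indicator function of the face
because no other inequality degenerates on this hyperplane: among monomials which realize the
maximum on sets with non-empty interior, no three agree on a hyperplane (`Irredundant.exists_ne`).

Monomials which do not dominate on an open set do not matter: the essential ones already compute `f`
(`exists_essential_eq`).  For two essential exponents the facet agrees, up to a null set, with its
part `openFacet` where no third essential monomial is maximal, and this part is empty unless the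
exponents form a facet pair.
-/

open MeasureTheory Filter Topology

/-! ### The measure of hyperplanes -/

section HyperplaneCoordinates
variable {E : Type*} [NormedAddCommGroup E] [InnerProductSpace ℝ E] [FiniteDimensional ℝ E]
  [MeasurableSpace E] [BorelSpace E]

/-- Fubini's theorem in coordinates adapted to the hyperplane `p + v^⊥`, with the coordinate along
`v` stretched by `t`. -/
theorem integral_eq_hyperplane_coords {v : E} (hv : v ≠ 0) {t : ℝ} (ht : t ≠ 0) (p : E)
    (g : E → ℝ) :
    ∫ x, g x = |t| * ‖v‖ *
      ∫ q : ℝ × (Submodule.span ℝ {v})ᗮ, g (p + (t * q.1) • v + (q.2 : E)) := by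
  have hs : Module.finrank ℝ (Submodule.span ℝ {v}) = 1 := finrank_span_singleton hv
  let v' : Submodule.span ℝ {v} :=
    ⟨t • v, Submodule.smul_mem _ _ (Submodule.mem_span_singleton_self v)⟩
  have hv' : v' ≠ 0 := by
    intro h
    have := congrArg Subtype.val h
    simp [v', hv, ht] at this
  have hvol := volume_eq_of_finrank_eq_one hs hv'
  have hemb : MeasurableEmbedding (fun r : ℝ => r • v') :=
    (isClosedEmbedding_smul_left hv').measurableEmbedding
  have h1 := ((Submodule.span ℝ {v}).measurePreserving_measurableEquivProd p)
  rw [InnerProductSpace.euclideanHausdorffMeasure_eq_volume] at h1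
  rw [← h1.symm.integral_comp' g, Measure.volume_eq_prod, hvol, Measure.prod_smul_left,
    integral_smul_measure]
  have h2 : ((volume : Measure ℝ).map (fun r : ℝ => r • v')).prod
      (volume : Measure ((Submodule.span ℝ {v})ᗮ : Submodule ℝ E)) =
      ((volume : Measure ℝ).prod volume).map (Prod.map (fun r : ℝ => r • v') id) := by
    rw [← Measure.map_prod_map _ _ hemb.measurable measurable_id, Measure.map_id]
  rw [h2, (hemb.prodMap MeasurableEmbedding.id).integral_map, ← Measure.volume_eq_prod]
  simp only [Submodule.measurableEquivProd_symm_apply, Prod.map, id, vadd_eq_add, smul_eq_mul]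
  congr 1
  · simp [v', norm_smul]
  · congr 1
    funext q
    congr 1
    simp only [v', SetLike.mk_smul_mk, smul_smul]
    rw [mul_comm q.1 t]
    abel

/-- The Euclidean Hausdorff measure of an affine hyperplane is the Lebesgue measure of its
direction, translated by one of its points. -/
theorem map_volume_hyperplane {d : ℕ} (hd : Module.finrank ℝ E = d + 1) {v : E} (hv : v ≠ 0)
    {c : ℝ} {p : E} (hp : c + inner ℝ v p = 0) :
    Measure.map (fun y : (Submodule.span ℝ {v})ᗮ => p + (y : E)) volume =
      (μHE[d] : Measure E).restrict {x | c + inner ℝ v x = 0} := by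
  have : Fact (Module.finrank ℝ E = d + 1) := ⟨hd⟩
  have hr : Module.finrank ℝ (Submodule.span ℝ {v})ᗮ = d :=
    Submodule.finrank_orthogonal_span_singleton hv
  have hiso : Isometry (fun y : (Submodule.span ℝ {v})ᗮ => p + (y : E)) :=
    (IsometryEquiv.addLeft p).isometry.comp isometry_subtype_coe
  have := hiso.map_euclideanHausdorffMeasure (d := Module.finrank ℝ (Submodule.span ℝ {v})ᗮ)
  rw [InnerProductSpace.euclideanHausdorffMeasure_eq_volume, hr] at this
  rw [this]
  congr 1
  ext x
  simp only [Set.mem_range, Set.mem_ofPred_eq]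
  constructor
  · rintro ⟨y, rfl⟩
    have := Submodule.mem_orthogonal_singleton_iff_inner_right.1 y.2
    rw [inner_add_right, this]; linarith
  · intro hx
    refine ⟨⟨x - p, Submodule.mem_orthogonal_singleton_iff_inner_right.2 ?_⟩, by simp⟩
    rw [inner_sub_right]; linarith

omit [FiniteDimensional ℝ E] [MeasurableSpace E] [BorelSpace E] in
theorem exists_affine_eq_zero {v : E} (hv : v ≠ 0) (c : ℝ) : ∃ p : E, c + inner ℝ v p = 0 := by
  have : ‖v‖ ≠ 0 := norm_ne_zero_iff.2 hv
  refine ⟨(-c / ‖v‖ ^ 2) • v, ?_⟩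
  rw [inner_smul_right, real_inner_self_eq_norm_sq]
  field_simp
  ring

theorem measurableEmbedding_hyperplane (v p : E) :
    MeasurableEmbedding (fun y : (Submodule.span ℝ {v})ᗮ => p + (y : E)) :=
  (Homeomorph.addLeft p).measurableEmbedding.comp
    (MeasurableEmbedding.subtype_coe (Submodule.closed_of_finiteDimensional _).measurableSet)

/-- The zero set of an affine function which is not identically zero is a null set. -/
theorem volume_affine_zero_set (c : ℝ) (ℓ : E →L[ℝ] ℝ) (h : ∃ y, c + ℓ y ≠ 0) :
    volume {y | c + ℓ y = 0} = 0 := by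
  by_cases hne : ∃ p, c + ℓ p = 0
  · obtain ⟨p, hp⟩ := hne
    have : {y | c + ℓ y = 0} = (AffineSubspace.mk' p (LinearMap.ker ℓ.toLinearMap) : Set E) := by
      ext y
      simp only [Set.mem_ofPred_eq, SetLike.mem_coe, AffineSubspace.mem_mk', vsub_eq_sub,
        LinearMap.mem_ker, ContinuousLinearMap.coe_coe, map_sub]
      constructor <;> intro h <;> linarith
    rw [this]
    refine Measure.addHaar_affineSubspace _ _ fun htop => ?_
    obtain ⟨y, hy⟩ := h
    apply hy
    have : y ∈ ({y | c + ℓ y = 0} : Set E) := by rw [this, htop]; trivial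
    exact this
  · push Not at hne
    have : {y | c + ℓ y = 0} = ∅ := Set.eq_empty_of_forall_notMem fun y hy => hne y hy
    rw [this, measure_empty]

end HyperplaneCoordinates

/-! ### Boundary layers of half-spaces -/

section SmoothStep
open Real (smoothTransition)

theorem differentiable_smoothTransition : Differentiable ℝ smoothTransition :=
  (Real.smoothTransition.contDiff (n := 1)).differentiable (by simp)

theorem continuous_deriv_smoothTransition : Continuous (deriv smoothTransition) :=
  (Real.smoothTransition.contDiff (n := 1)).continuous_deriv (by simp)

theorem deriv_smoothTransition_eq_zero {t : ℝ} (ht : t ∉ Set.Icc (0 : ℝ) 1) :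
    deriv smoothTransition t = 0 := by
  rw [Set.mem_Icc, not_and_or, not_le, not_le] at ht
  rcases ht with ht | ht
  · have : smoothTransition =ᶠ[𝓝 t] fun _ => 0 := by
      filter_upwards [Iio_mem_nhds ht] with s hs
      exact Real.smoothTransition.zero_of_nonpos (le_of_lt hs)
    rw [this.deriv_eq, deriv_const]
  · have : smoothTransition =ᶠ[𝓝 t] fun _ => 1 := by
      filter_upwards [Ioi_mem_nhds ht] with s hs
      exact Real.smoothTransition.one_of_one_le (le_of_lt hs)
    rw [this.deriv_eq, deriv_const]

theorem integrable_deriv_smoothTransition : Integrable (deriv smoothTransition) :=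
  continuous_deriv_smoothTransition.integrable_of_hasCompactSupport
    (HasCompactSupport.intro isCompact_Icc fun _ => deriv_smoothTransition_eq_zero)

theorem integral_deriv_smoothTransition : ∫ t, deriv smoothTransition t = 1 := by
  have h0 : Tendsto smoothTransition atBot (𝓝 0) :=
    tendsto_const_nhds.congr' (by
      filter_upwards [eventually_le_atBot (0 : ℝ)] with t ht
      exact (Real.smoothTransition.zero_of_nonpos ht).symm)
  have h1 : Tendsto smoothTransition atTop (𝓝 1) :=
    tendsto_const_nhds.congr' (by
      filter_upwards [eventually_ge_atTop (1 : ℝ)] with t ht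
      exact (Real.smoothTransition.one_of_one_le ht).symm)
  have := integral_of_hasDerivAt_of_tendsto
    (fun t => (differentiable_smoothTransition t).hasDerivAt)
    integrable_deriv_smoothTransition h0 h1
  simpa using this

theorem abs_smoothTransition_le_one (t : ℝ) : |smoothTransition t| ≤ 1 := by
  rw [abs_of_nonneg (Real.smoothTransition.nonneg t)]
  exact Real.smoothTransition.le_one t

theorem abs_prod_smoothTransition_le_one {ι : Type*} (J : Finset ι) (s : ι → ℝ) :
    |∏ k ∈ J, smoothTransition (s k)| ≤ 1 := by
  rw [Finset.abs_prod]
  exact Finset.prod_le_one (fun _ _ => abs_nonneg _) fun _ _ => abs_smoothTransition_le_one _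

/-- Rescaled by `ε → 0⁺`, the smooth step at a point `r + ε s` tends to the Heaviside function
of `r`, away from `r = 0`. -/
theorem tendsto_smoothTransition_div {r : ℝ} (hr : r ≠ 0) (s : ℝ) :
    Tendsto (fun ε => smoothTransition ((r + ε * s) / ε)) (𝓝[>] 0)
      (𝓝 (if 0 < r then 1 else 0)) := by
  have hs : Tendsto (fun ε : ℝ => r + ε * (s - 1)) (𝓝[>] 0) (𝓝 r) := by
    have : Tendsto (fun ε : ℝ => r + ε * (s - 1)) (𝓝 0) (𝓝 (r + 0 * (s - 1))) := by
      apply Continuous.tendsto; fun_prop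
    simpa using this.mono_left nhdsWithin_le_nhds
  have hs' : Tendsto (fun ε : ℝ => r + ε * s) (𝓝[>] 0) (𝓝 r) := by
    have : Tendsto (fun ε : ℝ => r + ε * s) (𝓝 0) (𝓝 (r + 0 * s)) := by
      apply Continuous.tendsto; fun_prop
    simpa using this.mono_left nhdsWithin_le_nhds
  refine tendsto_const_nhds.congr' ?_
  rcases lt_or_gt_of_ne hr with h | h
  · rw [if_neg h.not_gt]
    filter_upwards [hs'.eventually (Iio_mem_nhds h), self_mem_nhdsWithin] with ε h1 hε
    exact (Real.smoothTransition.zero_of_nonpos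
      (div_nonpos_of_nonpos_of_nonneg (le_of_lt h1) (le_of_lt hε))).symm
  · rw [if_pos h]
    filter_upwards [hs.eventually (Ioi_mem_nhds h), self_mem_nhdsWithin] with ε h1 hε
    refine (Real.smoothTransition.one_of_one_le ?_).symm
    rw [le_div_iff₀ hε]
    have h1' : 0 < r + ε * (s - 1) := h1
    linarith

end SmoothStep

section BoundaryLayer
open Real (smoothTransition)
variable {E : Type*} [NormedAddCommGroup E] [InnerProductSpace ℝ E] [FiniteDimensional ℝ E]
  [MeasurableSpace E] [BorelSpace E]

theorem setIntegral_hyperplane {d : ℕ} (hd : Module.finrank ℝ E = d + 1) {v : E} (hv : v ≠ 0)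
    {c : ℝ} {p : E} (hp : c + inner ℝ v p = 0) {S : Set E} (hS : MeasurableSet S) (φ : E → ℝ) :
    ∫ x in {x | c + inner ℝ v x = 0} ∩ S, φ x ∂μHE[d] =
      ∫ y : (Submodule.span ℝ {v})ᗮ, S.indicator φ (p + (y : E)) := by
  rw [← (measurableEmbedding_hyperplane v p).integral_map (S.indicator φ),
    map_volume_hyperplane hd hv hp, integral_indicator hS, Set.inter_comm,
    Measure.restrict_restrict hS]

omit [FiniteDimensional ℝ E] [MeasurableSpace E] [BorelSpace E] in
theorem isOpen_affine_pos {ι : Type*} (J : Finset ι) (c : ι → ℝ) (v : ι → E) :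
    IsOpen {x : E | ∀ k ∈ J, 0 < c k + inner ℝ (v k) x} := by
  have : {x : E | ∀ k ∈ J, 0 < c k + inner ℝ (v k) x} =
      ⋂ k ∈ J, {x : E | 0 < c k + inner ℝ (v k) x} := by ext; simp
  rw [this]
  exact isOpen_biInter_finset fun k _ => isOpen_lt continuous_const (by fun_prop)

omit [FiniteDimensional ℝ E] in
theorem measurableSet_affine_pos {ι : Type*} (J : Finset ι) (c : ι → ℝ) (v : ι → E) :
    MeasurableSet {x : E | ∀ k ∈ J, 0 < c k + inner ℝ (v k) x} :=
  (isOpen_affine_pos J c v).measurableSet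

/-- The derivative of a rescaled smooth step along the affine function `c j + ⟪v j, x⟫`, cut off by
rescaled smooth steps along the other affine functions, concentrates on the part of the hyperplane
`c j + ⟪v j, x⟫ = 0` where the others are positive. -/
theorem tendsto_boundary_layer {d : ℕ} (hd : Module.finrank ℝ E = d + 1) {ι : Type*}
    (J : Finset ι) (c : ι → ℝ) (v : ι → E) (j : ι) (hv : v j ≠ 0)
    (hJ : ∀ k ∈ J, ∃ x, c j + inner ℝ (v j) x = 0 ∧ c k + inner ℝ (v k) x ≠ 0)
    {φ : E → ℝ} (hφ : Continuous φ) (hφc : HasCompactSupport φ) :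
    Tendsto (fun ε : ℝ => ∫ x, ε⁻¹ * deriv smoothTransition ((c j + inner ℝ (v j) x) / ε) *
        (∏ k ∈ J, smoothTransition ((c k + inner ℝ (v k) x) / ε)) * φ x) (𝓝[>] 0)
      (𝓝 (‖v j‖⁻¹ * ∫ x in {x | c j + inner ℝ (v j) x = 0} ∩
        {x | ∀ k ∈ J, 0 < c k + inner ℝ (v k) x}, φ x ∂μHE[d])) := by
  have hn : 0 < ‖v j‖ := norm_pos_iff.2 hv
  have hn2 : inner ℝ (v j) (v j) = ‖v j‖ ^ 2 := real_inner_self_eq_norm_sq _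
  obtain ⟨p, hp⟩ := exists_affine_eq_zero hv (c j)
  have hy (y : (Submodule.span ℝ {v j})ᗮ) : inner ℝ (v j) (y : E) = 0 :=
    Submodule.mem_orthogonal_singleton_iff_inner_right.1 y.2
  set G : ℝ → ℝ × (Submodule.span ℝ {v j})ᗮ → ℝ := fun ε q =>
    deriv smoothTransition q.1 *
      (∏ k ∈ J, smoothTransition ((c k + inner ℝ (v k) (p + (q.2 : E)) +
        ε * (q.1 / ‖v j‖ ^ 2 * inner ℝ (v k) (v j))) / ε)) *
      φ (p + (ε / ‖v j‖ ^ 2 * q.1) • v j + (q.2 : E)) with hG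
  -- Coordinates adapted to the hyperplane, stretched by `ε` in the normal direction.
  have hcoord : ∀ ε ∈ Set.Ioi (0 : ℝ), ‖v j‖⁻¹ * ∫ q, G ε q =
      ∫ x, ε⁻¹ * deriv smoothTransition ((c j + inner ℝ (v j) x) / ε) *
        (∏ k ∈ J, smoothTransition ((c k + inner ℝ (v k) x) / ε)) * φ x := by
    intro ε hε
    have hε : 0 < ε := hε
    have ht : ε / ‖v j‖ ^ 2 ≠ 0 := by positivity
    rw [integral_eq_hyperplane_coords hv ht p, abs_of_pos (by positivity),
      ← integral_const_mul, ← integral_const_mul]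
    congr 1
    funext q
    have e1 : (c j + inner ℝ (v j) (p + (ε / ‖v j‖ ^ 2 * q.1) • v j + (q.2 : E))) / ε = q.1 := by
      rw [inner_add_right, inner_add_right, inner_smul_right, hn2, hy]
      have : c j + (inner ℝ (v j) p + ε / ‖v j‖ ^ 2 * q.1 * ‖v j‖ ^ 2 + 0) = ε * q.1 := by
        have : ε / ‖v j‖ ^ 2 * q.1 * ‖v j‖ ^ 2 = ε * q.1 := by field_simp
        linarith
      rw [this]; field_simp
    have e2 (k : ι) : c k + inner ℝ (v k) (p + (ε / ‖v j‖ ^ 2 * q.1) • v j + (q.2 : E)) =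
        c k + inner ℝ (v k) (p + (q.2 : E)) +
        ε * (q.1 / ‖v j‖ ^ 2 * inner ℝ (v k) (v j)) := by
      simp only [inner_add_right, inner_smul_right]; ring
    rw [e1]
    simp only [e2, hG]
    have e3 : ‖v j‖⁻¹ = ε / ‖v j‖ ^ 2 * ‖v j‖ * ε⁻¹ := by field_simp
    rw [e3]
    ring
  refine Tendsto.congr' (eventually_nhdsWithin_of_forall hcoord) (Tendsto.const_mul _ ?_)
  set S : Set E := {x | ∀ k ∈ J, 0 < c k + inner ℝ (v k) x} with hS
  have hSm : MeasurableSet S := measurableSet_affine_pos J c v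
  have hlim : ∫ x in {x | c j + inner ℝ (v j) x = 0} ∩ S, φ x ∂μHE[d] =
      ∫ q : ℝ × (Submodule.span ℝ {v j})ᗮ,
        deriv smoothTransition q.1 * S.indicator φ (p + (q.2 : E)) := by
    rw [setIntegral_hyperplane hd hv hp hSm, Measure.volume_eq_prod,
      integral_prod_mul (fun t => deriv smoothTransition t)
        (fun y : (Submodule.span ℝ {v j})ᗮ => S.indicator φ (p + (y : E))),
      integral_deriv_smoothTransition, one_mul]
  rw [hlim]
  obtain ⟨C, hC⟩ := hφ.bounded_above_of_compact_support hφc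
  obtain ⟨R, hR⟩ := hφc.isCompact.isBounded.subset_closedBall (0 : E)
  -- For `ε ≤ 1`, the stretched integrands vanish unless the tangential coordinate is at most `R'`.
  set R' := R + ‖p‖ + ‖v j‖ / ‖v j‖ ^ 2 with hR'
  refine tendsto_integral_filter_of_dominated_convergence
    (fun q => ‖deriv smoothTransition q.1‖ *
      (Metric.closedBall (0 : (Submodule.span ℝ {v j})ᗮ) R').indicator (fun _ => C) q.2)
    ?_ ?_ ?_ ?_
  · filter_upwards [self_mem_nhdsWithin] with ε hε
    have := continuous_deriv_smoothTransition
    have := Real.smoothTransition.continuous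
    apply Continuous.aestronglyMeasurable
    fun_prop
  · filter_upwards [self_mem_nhdsWithin, nhdsWithin_le_nhds (Iic_mem_nhds one_pos)] with ε hε hε1
    have hε : 0 < ε := hε
    have hε1 : ε ≤ 1 := hε1
    refine Eventually.of_forall fun q => ?_
    rw [hG]
    simp only [norm_mul]
    by_cases hq : q.1 ∈ Set.Icc (0 : ℝ) 1
    swap
    · rw [deriv_smoothTransition_eq_zero hq]; simp
    rw [mul_assoc]
    refine mul_le_mul_of_nonneg_left ?_ (norm_nonneg _)
    by_cases hz : φ (p + (ε / ‖v j‖ ^ 2 * q.1) • v j + (q.2 : E)) = 0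
    · rw [hz, norm_zero, mul_zero]
      refine Set.indicator_nonneg (fun _ _ => (norm_nonneg _).trans (hC 0)) _
    · have hmem := hR (subset_tsupport _ hz)
      rw [mem_closedBall_zero_iff] at hmem
      have hmem2 : q.2 ∈ Metric.closedBall (0 : (Submodule.span ℝ {v j})ᗮ) R' := by
        rw [mem_closedBall_zero_iff]
        have h1 : ‖(ε / ‖v j‖ ^ 2 * q.1) • v j‖ ≤ ‖v j‖ / ‖v j‖ ^ 2 := by
          rw [norm_smul, Real.norm_of_nonneg (mul_nonneg (by positivity) hq.1),
            div_mul_eq_mul_div, div_mul_eq_mul_div]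
          gcongr
          have : ε * q.1 ≤ 1 := mul_le_one₀ hε1 hq.1 hq.2
          nlinarith
        have h2 : (q.2 : E) = (p + (ε / ‖v j‖ ^ 2 * q.1) • v j + (q.2 : E)) - p -
          (ε / ‖v j‖ ^ 2 * q.1) • v j := by abel
        have h3 : ‖(q.2 : E)‖ ≤ R + ‖p‖ + ‖v j‖ / ‖v j‖ ^ 2 := by
          rw [h2]
          refine (norm_sub_le _ _).trans (add_le_add ((norm_sub_le _ _).trans ?_) h1)
          gcongr
        simpa using h3
      rw [Set.indicator_of_mem hmem2]
      calc _ ≤ 1 * C := mul_le_mul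
              ((Real.norm_eq_abs _).trans_le (abs_prod_smoothTransition_le_one J _)) (hC _)
              (norm_nonneg _) zero_le_one
        _ = C := one_mul C
  · rw [Measure.volume_eq_prod]
    refine Integrable.mul_prod integrable_deriv_smoothTransition.norm ?_
    refine (integrable_indicator_iff Metric.isClosed_closedBall.measurableSet).2 ?_
    exact integrableOn_const (isCompact_closedBall _ _).measure_ne_top
  · have hnull : ∀ᵐ q : ℝ × (Submodule.span ℝ {v j})ᗮ, ∀ k ∈ J,
        c k + inner ℝ (v k) (p + (q.2 : E)) ≠ 0 := by
      refine (eventually_all_finset J).2 fun k hk => ?_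
      have h1 : ∀ᵐ y : (Submodule.span ℝ {v j})ᗮ, c k + inner ℝ (v k) (p + (y : E)) ≠ 0 := by
        have := volume_affine_zero_set (c k + inner ℝ (v k) p)
          ((innerSL ℝ (v k)).comp (Submodule.subtypeL (Submodule.span ℝ {v j})ᗮ)) (by
            obtain ⟨x, hx, hx'⟩ := hJ k hk
            refine ⟨⟨x - p, Submodule.mem_orthogonal_singleton_iff_inner_right.2 ?_⟩, ?_⟩
            · rw [inner_sub_right]; linarith
            · simpa [inner_sub_right] using hx')
        rw [ae_iff]
        convert this using 3 with y
        simp [inner_add_right, add_assoc]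
      rw [Measure.volume_eq_prod]
      exact Measure.quasiMeasurePreserving_snd.ae h1
    filter_upwards [hnull] with q hq
    have hprod : Tendsto (fun ε : ℝ => ∏ k ∈ J, smoothTransition
        ((c k + inner ℝ (v k) (p + (q.2 : E)) + ε * (q.1 / ‖v j‖ ^ 2 * inner ℝ (v k) (v j))) / ε))
        (𝓝[>] 0) (𝓝 (∏ k ∈ J, if 0 < c k + inner ℝ (v k) (p + (q.2 : E)) then (1 : ℝ) else 0)) :=
      tendsto_finsetProd _ fun k hk => tendsto_smoothTransition_div (hq k hk) _
    have hφt : Tendsto (fun ε : ℝ => φ (p + (ε / ‖v j‖ ^ 2 * q.1) • v j + (q.2 : E))) (𝓝[>] 0)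
        (𝓝 (φ (p + (q.2 : E)))) := by
      have : Tendsto (fun ε : ℝ => φ (p + (ε / ‖v j‖ ^ 2 * q.1) • v j + (q.2 : E))) (𝓝 0)
        (𝓝 (φ (p + ((0 : ℝ) / ‖v j‖ ^ 2 * q.1) • v j + (q.2 : E)))) :=
        (by fun_prop : Continuous fun ε : ℝ =>
          φ (p + (ε / ‖v j‖ ^ 2 * q.1) • v j + (q.2 : E))).tendsto 0
      simpa using this.mono_left nhdsWithin_le_nhds
    have := (tendsto_const_nhds (x := deriv smoothTransition q.1)).mul hprod |>.mul hφt
    convert this using 2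
    rw [mul_assoc]
    congr 1
    rw [Finset.prod_ite_zero]
    by_cases hmem : p + (q.2 : E) ∈ S
    · rw [Set.indicator_of_mem hmem, if_pos (show ∀ k ∈ J, _ from hmem)]; simp
    · rw [Set.indicator_of_notMem hmem, if_neg (show ¬ ∀ k ∈ J, _ from hmem)]; simp

end BoundaryLayer

/-! ### The divergence theorem for convex polyhedra -/

section PolyhedronDivergence
open Real (smoothTransition)
variable {E : Type*} [NormedAddCommGroup E] [InnerProductSpace ℝ E]

theorem tendsto_smoothTransition_div_self (r : ℝ) :
    Tendsto (fun ε => smoothTransition (r / ε)) (𝓝[>] 0) (𝓝 (if 0 < r then 1 else 0)) := by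
  by_cases hr : r = 0
  · simp [hr]
  · simpa using tendsto_smoothTransition_div hr 0

theorem hasFDerivAt_prod_smoothTransition {ι : Type*} [DecidableEq ι] (J : Finset ι) (c : ι → ℝ)
    (v : ι → E) (ε : ℝ) (x : E) :
    HasFDerivAt (fun x => ∏ k ∈ J, smoothTransition ((c k + inner ℝ (v k) x) / ε))
      (∑ j ∈ J, (∏ k ∈ J.erase j, smoothTransition ((c k + inner ℝ (v k) x) / ε)) •
        (deriv smoothTransition ((c j + inner ℝ (v j) x) / ε) • (ε⁻¹ • innerSL ℝ (v j)))) x := by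
  refine HasFDerivAt.finsetProd fun k _ => ?_
  have h1 : HasFDerivAt (fun x : E => (c k + inner ℝ (v k) x) / ε) (ε⁻¹ • innerSL ℝ (v k)) x := by
    have := ((innerSL ℝ (v k)).hasFDerivAt (x := x)).const_add (c k) |>.const_mul ε⁻¹
    simpa [div_eq_inv_mul] using this
  exact (differentiable_smoothTransition _).hasDerivAt.comp_hasFDerivAt x h1

variable [FiniteDimensional ℝ E] [MeasurableSpace E] [BorelSpace E]

/-- **Divergence theorem** for an open convex polyhedron: the interior normal of the face on
which `c j + ⟪v j, x⟫` vanishes is `v j / ‖v j‖`.  No face may be contained in the boundary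
hyperplane of another inequality. -/
theorem integral_fderiv_openPolyhedron {d : ℕ} (hd : Module.finrank ℝ E = d + 1) {ι : Type*}
    [DecidableEq ι] (J : Finset ι) (c : ι → ℝ) (v : ι → E) (hv : ∀ j ∈ J, v j ≠ 0)
    (hJ : ∀ j ∈ J, ∀ k ∈ J.erase j,
      ∃ x, c j + inner ℝ (v j) x = 0 ∧ c k + inner ℝ (v k) x ≠ 0)
    {φ : E → ℝ} (hφ : ContDiff ℝ 1 φ) (hφc : HasCompactSupport φ) (w : E) :
    ∫ x in {x | ∀ k ∈ J, 0 < c k + inner ℝ (v k) x}, fderiv ℝ φ x w =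
      -∑ j ∈ J, inner ℝ (v j) w / ‖v j‖ * ∫ x in {x | c j + inner ℝ (v j) x = 0} ∩
        {x | ∀ k ∈ J.erase j, 0 < c k + inner ℝ (v k) x}, φ x ∂μHE[d] := by
  have hφ' : Continuous fun x => fderiv ℝ φ x w :=
    (hφ.continuous_fderiv (by simp)).clm_apply continuous_const
  have hφ'c : HasCompactSupport fun x => fderiv ℝ φ x w :=
    (hφc.fderiv (𝕜 := ℝ)).comp_left (g := fun A : E →L[ℝ] ℝ => A w) (by simp)
  have hsc := Real.smoothTransition.continuous
  have hsd := continuous_deriv_smoothTransition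
  -- Both sides are limits of the integral of the derivative against a smoothed indicator function.
  have h1 : Tendsto (fun ε : ℝ => ∫ x, (∏ k ∈ J, smoothTransition ((c k + inner ℝ (v k) x) / ε)) *
      fderiv ℝ φ x w) (𝓝[>] 0)
      (𝓝 (∫ x in {x | ∀ k ∈ J, 0 < c k + inner ℝ (v k) x}, fderiv ℝ φ x w)) := by
    rw [← integral_indicator (measurableSet_affine_pos J c v)]
    refine tendsto_integral_filter_of_dominated_convergence (fun x => ‖fderiv ℝ φ x w‖)
      (Eventually.of_forall fun ε => ?_) (Eventually.of_forall fun ε => ae_of_all _ fun x => ?_)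
      (hφ'.integrable_of_hasCompactSupport hφ'c).norm (ae_of_all _ fun x => ?_)
    · apply Continuous.aestronglyMeasurable
      fun_prop
    · rw [norm_mul]
      exact mul_le_of_le_one_left (norm_nonneg _)
        ((Real.norm_eq_abs _).trans_le (abs_prod_smoothTransition_le_one J _))
    · have := (tendsto_finsetProd J fun k _ =>
        tendsto_smoothTransition_div_self (c k + inner ℝ (v k) x)).mul_const (fderiv ℝ φ x w)
      convert this using 2
      rw [Finset.prod_ite_zero]
      simp [Set.indicator_apply]
  have h2 : ∀ ε : ℝ, -∑ j ∈ J, inner ℝ (v j) w *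
        (∫ x, ε⁻¹ * deriv smoothTransition ((c j + inner ℝ (v j) x) / ε) *
        (∏ k ∈ J.erase j, smoothTransition ((c k + inner ℝ (v k) x) / ε)) * φ x) =
      ∫ x, (∏ k ∈ J, smoothTransition ((c k + inner ℝ (v k) x) / ε)) * fderiv ℝ φ x w := by
    intro ε
    have hfd : ∀ x,
        fderiv ℝ (fun x => ∏ k ∈ J, smoothTransition ((c k + inner ℝ (v k) x) / ε)) x w =
        ∑ j ∈ J, inner ℝ (v j) w *
          (ε⁻¹ * deriv smoothTransition ((c j + inner ℝ (v j) x) / ε) *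
          (∏ k ∈ J.erase j, smoothTransition ((c k + inner ℝ (v k) x) / ε))) := by
      intro x
      rw [(hasFDerivAt_prod_smoothTransition J c v ε x).fderiv]
      simp only [sum_apply, smul_apply, innerSL_apply_apply,
        smul_eq_mul]
      exact Finset.sum_congr rfl fun _ _ => by ring
    have hint : ∀ j, Integrable fun x =>
        ε⁻¹ * deriv smoothTransition ((c j + inner ℝ (v j) x) / ε) *
          (∏ k ∈ J.erase j, smoothTransition ((c k + inner ℝ (v k) x) / ε)) * φ x := by
      intro j
      refine Continuous.integrable_of_hasCompactSupport ?_ hφc.mul_left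
      have := hφ.continuous
      fun_prop
    rw [integral_mul_fderiv_eq_neg_fderiv_mul_of_integrable]
    · congr 1
      simp_rw [hfd, Finset.sum_mul, mul_assoc]
      rw [integral_finsetSum]
      · simp_rw [← mul_assoc]
        refine Finset.sum_congr rfl fun j _ => ?_
        rw [← integral_const_mul]
        simp_rw [← mul_assoc]
      · intro j _
        simpa only [mul_assoc] using (hint j).const_mul (inner ℝ (v j) w)
    · simp_rw [hfd, Finset.sum_mul]
      refine integrable_finsetSum _ fun j _ => ?_
      simpa only [mul_assoc] using (hint j).const_mul (inner ℝ (v j) w)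
    · refine Continuous.integrable_of_hasCompactSupport ?_ hφ'c.mul_left
      fun_prop
    · refine Continuous.integrable_of_hasCompactSupport ?_ hφc.mul_left
      have := hφ.continuous
      fun_prop
    · exact fun x _ => (hasFDerivAt_prod_smoothTransition J c v ε x).differentiableAt
    · exact fun x _ => hφ.differentiable (by simp) x
  refine tendsto_nhds_unique h1 (Tendsto.congr h2 ?_)
  refine (tendsto_finsetSum J fun j hj => ?_).neg
  rw [div_mul_eq_mul_div, mul_div_assoc, div_eq_inv_mul]
  exact (tendsto_boundary_layer hd (J.erase j) c v j (hv j hj) (hJ j hj) hφ.continuous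
    hφc).const_mul _

end PolyhedronDivergence

/-! ### Second derivatives of a maximum of affine functions -/

section MaxAffine
variable {E : Type*} [NormedAddCommGroup E] [InnerProductSpace ℝ E] {ι : Type*} [DecidableEq ι]

/-- The open polyhedron on which the `i`-th of the affine functions `c k + ⟪a k, x⟫`, `k ∈ A`, is
strictly larger than all the others. -/
def openCell (A : Finset ι) (c : ι → ℝ) (a : ι → E) (i : ι) : Set E :=
  {x | ∀ j ∈ A.erase i, 0 < (c i - c j) + inner ℝ (a i - a j) x}

/-- The part of the hyperplane `c i + ⟪a i, x⟫ = c j + ⟪a j, x⟫` on which this common value is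
strictly larger than all the other affine functions `c k + ⟪a k, x⟫`, `k ∈ A`. -/
def openFacet (A : Finset ι) (c : ι → ℝ) (a : ι → E) (i j : ι) : Set E :=
  {x | (c i - c j) + inner ℝ (a i - a j) x = 0} ∩
    {x | ∀ k ∈ (A.erase i).erase j, 0 < (c i - c k) + inner ℝ (a i - a k) x}

/-- Every one of the affine functions `c k + ⟪a k, x⟫`, `k ∈ A`, is somewhere strictly larger than
all the others. -/
def Irredundant (A : Finset ι) (c : ι → ℝ) (a : ι → E) : Prop :=
  ∀ i ∈ A, (openCell A c a i).Nonempty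

variable {A : Finset ι} {c : ι → ℝ} {a : ι → E}

theorem mem_openCell {i : ι} {x : E} : x ∈ openCell A c a i ↔
    ∀ j ∈ A, j ≠ i → c j + inner ℝ (a j) x < c i + inner ℝ (a i) x := by
  simp only [openCell, Set.mem_ofPred_eq, Finset.mem_erase, inner_sub_left]
  constructor
  · intro h j hj hne
    have := h j ⟨hne, hj⟩
    linarith
  · intro h j hj
    have := h j hj.2 hj.1
    linarith

theorem mem_openFacet {i j : ι} {x : E} : x ∈ openFacet A c a i j ↔
    c i + inner ℝ (a i) x = c j + inner ℝ (a j) x ∧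
    ∀ k ∈ A, k ≠ i → k ≠ j → c k + inner ℝ (a k) x < c i + inner ℝ (a i) x := by
  simp only [openFacet, Set.mem_inter_iff, Set.mem_ofPred_eq, Finset.mem_erase, inner_sub_left]
  constructor
  · rintro ⟨h1, h⟩
    refine ⟨by linarith, fun k hk hi hj => ?_⟩
    have := h k ⟨hj, hi, hk⟩
    linarith
  · rintro ⟨h1, h⟩
    refine ⟨by linarith, fun k hk => ?_⟩
    have := h k hk.2.2 hk.2.1 hk.1
    linarith

theorem openFacet_comm (i j : ι) : openFacet A c a i j = openFacet A c a j i := by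
  ext x
  simp only [mem_openFacet]
  constructor
  · rintro ⟨h1, h⟩
    exact ⟨h1.symm, fun k hk hj hi => h1 ▸ h k hk hi hj⟩
  · rintro ⟨h1, h⟩
    exact ⟨h1.symm, fun k hk hj hi => h1 ▸ h k hk hi hj⟩

theorem Irredundant.slope_sub_ne_zero (h : Irredundant A c a) {i j : ι} (hi : i ∈ A) (hj : j ∈ A)
    (hij : i ≠ j) : a i - a j ≠ 0 := by
  intro h0
  obtain ⟨x, hx⟩ := h i hi
  obtain ⟨y, hy⟩ := h j hj
  have h1 := mem_openCell.1 hx j hj hij.symm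
  have h2 := mem_openCell.1 hy i hi hij
  rw [sub_eq_zero.1 h0] at h1 h2
  linarith

/-- Two affine functions, the second of which vanishes on the zero set of the first, are in a fixed
ratio at points where the first has opposite signs. -/
theorem affine_ratio_of_zero_subset {b₁ b₂ : ℝ} {v₁ v₂ x y : E}
    (h : ∀ z, b₁ + inner ℝ v₁ z = 0 → b₂ + inner ℝ v₂ z = 0)
    (hx : 0 < b₁ + inner ℝ v₁ x) (hy : b₁ + inner ℝ v₁ y < 0) :
    (b₁ + inner ℝ v₁ x) * (b₂ + inner ℝ v₂ y) = (b₁ + inner ℝ v₁ y) * (b₂ + inner ℝ v₂ x) := by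
  set p := b₁ + inner ℝ v₁ x with hp
  set q := b₁ + inner ℝ v₁ y with hq
  have hpq : p - q ≠ 0 := by linarith
  have key := h ((p - q)⁻¹ • (p • y - q • x)) (by
    rw [inner_smul_right, inner_sub_right, inner_smul_right, inner_smul_right]
    field_simp
    rw [show inner ℝ v₁ x = p - b₁ by linarith, show inner ℝ v₁ y = q - b₁ by linarith]
    ring)
  rw [inner_smul_right, inner_sub_right, inner_smul_right, inner_smul_right] at key
  field_simp at key
  linarith

/-- No three of the affine functions of an irredundant family agree on a hyperplane: the middle one
would nowhere be strictly largest. -/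
theorem Irredundant.exists_ne (h : Irredundant A c a) {i j k : ι} (hi : i ∈ A) (hj : j ∈ A)
    (hk : k ∈ A) (hij : i ≠ j) (hik : i ≠ k) (hjk : j ≠ k) :
    ∃ x, (c i - c j) + inner ℝ (a i - a j) x = 0 ∧ (c i - c k) + inner ℝ (a i - a k) x ≠ 0 := by
  by_contra! hcon
  obtain ⟨x, hx⟩ := h i hi
  obtain ⟨y, hy⟩ := h j hj
  obtain ⟨z, hz⟩ := h k hk
  have x1 := mem_openCell.1 hx j hj hij.symm
  have x2 := mem_openCell.1 hx k hk hik.symm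
  have y1 := mem_openCell.1 hy i hi hij
  have y2 := mem_openCell.1 hy k hk hjk.symm
  have z1 := mem_openCell.1 hz i hi hik
  have z2 := mem_openCell.1 hz j hj hjk
  have hxy := affine_ratio_of_zero_subset (x := x) (y := y) hcon
    (by rw [inner_sub_left]; linarith) (by rw [inner_sub_left]; linarith)
  have hzz := hcon z
  have hxz := fun hz' => affine_ratio_of_zero_subset (x := x) (y := z) hcon
    (by rw [inner_sub_left]; linarith) hz'
  have hzy := fun hz' => affine_ratio_of_zero_subset (x := z) (y := y) hcon
    hz' (by rw [inner_sub_left]; linarith)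
  simp only [inner_sub_left] at hxy hzz hxz hzy
  set p := c i - c j + (inner ℝ (a i) x - inner ℝ (a j) x)
  set p' := c i - c k + (inner ℝ (a i) x - inner ℝ (a k) x)
  set q := c i - c j + (inner ℝ (a i) y - inner ℝ (a j) y)
  set q' := c i - c k + (inner ℝ (a i) y - inner ℝ (a k) y)
  set r := c i - c j + (inner ℝ (a i) z - inner ℝ (a j) z)
  set r' := c i - c k + (inner ℝ (a i) z - inner ℝ (a k) z)
  have hp : 0 < p := by linarith
  have hp' : 0 < p' := by linarith
  have hq : q < 0 := by linarith
  have hqq : q < q' := by linarith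
  have hr : r' < 0 := by linarith
  have hrr : r' < r := by linarith
  -- The ratio `p' / p` is less than one, by comparison with `y`.
  have hlt : p' < p := by
    by_contra hle
    push Not at hle
    nlinarith
  -- The same comparison with `z` contradicts this, on whichever side of the hyperplane `z` lies.
  rcases lt_trichotomy r 0 with h0 | h0 | h0
  · have := hxz h0
    nlinarith
  · have := hzz h0
    linarith
  · have := hzy h0
    have : 0 < q * r' := mul_pos_of_neg_of_neg hq hr
    have : q' < 0 := by
      by_contra hle
      push Not at hle
      nlinarith
    nlinarith

theorem openCell_disjoint {i j : ι} (hi : i ∈ A) (hj : j ∈ A) (hij : i ≠ j) {x : E}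
    (hx : x ∈ openCell A c a i) : x ∉ openCell A c a j := fun hx' =>
  lt_asymm (mem_openCell.1 hx j hj hij.symm) (mem_openCell.1 hx' i hi hij)

variable [FiniteDimensional ℝ E] [MeasurableSpace E] [BorelSpace E]

omit [FiniteDimensional ℝ E] in
theorem measurableSet_openCell (i : ι) : MeasurableSet (openCell A c a i) :=
  measurableSet_affine_pos (A.erase i) (fun j => c i - c j) fun j => a i - a j

omit [FiniteDimensional ℝ E] in
theorem measurableSet_openFacet (i j : ι) : MeasurableSet (openFacet A c a i j) := by
  refine MeasurableSet.inter ?_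
    (measurableSet_affine_pos ((A.erase i).erase j) (fun k => c i - c k) fun k => a i - a k)
  exact (isClosed_eq (by fun_prop) continuous_const).measurableSet

theorem integral_fderiv_openCell {d : ℕ} (hd : Module.finrank ℝ E = d + 1)
    (h : Irredundant A c a) {i : ι} (hi : i ∈ A) {φ : E → ℝ} (hφ : ContDiff ℝ 1 φ)
    (hφc : HasCompactSupport φ) (w : E) :
    ∫ x in openCell A c a i, fderiv ℝ φ x w =
      -∑ j ∈ A.erase i, inner ℝ (a i - a j) w / ‖a i - a j‖ *
        ∫ x in openFacet A c a i j, φ x ∂μHE[d] := by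
  refine integral_fderiv_openPolyhedron hd (A.erase i) (fun j => c i - c j) (fun j => a i - a j)
    (fun j hj => ?_) (fun j hj k hk => ?_) hφ hφc w
  · rw [Finset.mem_erase] at hj
    exact h.slope_sub_ne_zero hi hj.2 hj.1.symm
  · simp only [Finset.mem_erase] at hj hk
    exact h.exists_ne hi hj.2 hk.2.2 hj.1.symm hk.2.1.symm hk.1.symm

theorem sum_erase_eq_zero_of_antisymm (A : Finset ι) (g : ι → ι → ℝ)
    (hg : ∀ i ∈ A, ∀ j ∈ A, i ≠ j → g i j = -g j i) : ∑ i ∈ A, ∑ j ∈ A.erase i, g i j = 0 := by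
  have h1 : ∑ i ∈ A, ∑ j ∈ A.erase i, g i j = ∑ i ∈ A, ∑ j ∈ A.erase i, g j i :=
    Finset.sum_comm' (by simp only [Finset.mem_erase]; tauto)
  have h2 : ∑ i ∈ A, ∑ j ∈ A.erase i, g i j = -∑ i ∈ A, ∑ j ∈ A.erase i, g j i := by
    simp_rw [← Finset.sum_neg_distrib]
    refine Finset.sum_congr rfl fun i hi => Finset.sum_congr rfl fun j hj => ?_
    rw [Finset.mem_erase] at hj
    exact hg i hi j hj.2 hj.1.symm
  linarith

/-- The second distributional derivatives of a maximum of affine functions are carried by the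
facets, with density `⟪v, u⟫ ⟪v, w⟫ / ‖v‖` for a facet along which the gradient jumps by `v`.  Every
facet appears twice in the sum. -/
theorem integral_max_affine_mul_fderiv_fderiv {d : ℕ} (hd : Module.finrank ℝ E = d + 1)
    (h : Irredundant A c a) {F : E → ℝ}
    (hF : ∀ᵐ x, ∃ i ∈ A, x ∈ openCell A c a i ∧ F x = c i + inner ℝ (a i) x)
    {φ : E → ℝ} (hφ : ContDiff ℝ 2 φ) (hφc : HasCompactSupport φ) (u w : E) :
    ∫ x, F x * fderiv ℝ (fun y => fderiv ℝ φ y w) x u =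
      1 / 2 * ∑ i ∈ A, ∑ j ∈ A.erase i,
        inner ℝ (a i - a j) u * inner ℝ (a i - a j) w / ‖a i - a j‖ *
          ∫ x in openFacet A c a i j, φ x ∂μHE[d] := by
  set ψ : E → ℝ := fun y => fderiv ℝ φ y w with hψdef
  have hψ : ContDiff ℝ 1 ψ :=
    (hφ.fderiv_right (m := 1) (by norm_num)).clm_apply contDiff_const
  have hψc : HasCompactSupport ψ :=
    (hφc.fderiv (𝕜 := ℝ)).comp_left (g := fun A : E →L[ℝ] ℝ => A w) (by simp)
  have hψ' : Continuous fun x => fderiv ℝ ψ x u :=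
    (hψ.continuous_fderiv (by simp)).clm_apply continuous_const
  have hψ'c : HasCompactSupport fun x => fderiv ℝ ψ x u :=
    (hψc.fderiv (𝕜 := ℝ)).comp_left (g := fun A : E →L[ℝ] ℝ => A u) (by simp)
  have hint1 : ∀ i, Integrable fun x => (c i + inner ℝ (a i) x) * fderiv ℝ ψ x u := fun i =>
    Continuous.integrable_of_hasCompactSupport (by fun_prop) hψ'c.mul_left
  have hint2 : Integrable ψ := hψ.continuous.integrable_of_hasCompactSupport hψc
  have hsplit : ∫ x, F x * fderiv ℝ ψ x u =
      ∑ i ∈ A, ∫ x in openCell A c a i, (c i + inner ℝ (a i) x) * fderiv ℝ ψ x u := by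
    simp_rw [← integral_indicator (measurableSet_openCell (A := A) (c := c) (a := a) _)]
    rw [← integral_finsetSum _ fun i _ => (hint1 i).indicator (measurableSet_openCell i)]
    refine integral_congr_ae ?_
    filter_upwards [hF] with x hx
    obtain ⟨i, hi, hxi, hFx⟩ := hx
    rw [Finset.sum_eq_single i, Set.indicator_of_mem hxi, hFx]
    · exact fun j hj hji => Set.indicator_of_notMem (openCell_disjoint hi hj hji.symm hxi) _
    · exact fun hi' => absurd hi hi'
  -- On each cell, the product rule reduces to the divergence theorem, applied twice.
  have hcell : ∀ i ∈ A, ∫ x in openCell A c a i, (c i + inner ℝ (a i) x) * fderiv ℝ ψ x u =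
      -∑ j ∈ A.erase i, inner ℝ (a i - a j) u / ‖a i - a j‖ *
        ∫ x in openFacet A c a i j, (c i + inner ℝ (a i) x) * ψ x ∂μHE[d] +
      inner ℝ (a i) u * ∑ j ∈ A.erase i, inner ℝ (a i - a j) w / ‖a i - a j‖ *
        ∫ x in openFacet A c a i j, φ x ∂μHE[d] := by
    intro i hi
    have hl : ContDiff ℝ 1 fun x => c i + inner ℝ (a i) x :=
      contDiff_const.add (innerSL ℝ (a i)).contDiff
    have e1 := integral_fderiv_openCell hd h hi (hl.mul hψ) hψc.mul_left u
    have e2 := integral_fderiv_openCell hd h hi (hφ.of_le (by norm_num)) hφc w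
    rw [← e1, ← neg_eq_iff_eq_neg.2 e2, mul_neg, ← integral_const_mul, ← sub_eq_add_neg,
      ← integral_sub]
    · congr 1
      funext x
      have hd1 : HasFDerivAt (fun x => (c i + inner ℝ (a i) x) * ψ x)
          ((c i + inner ℝ (a i) x) • fderiv ℝ ψ x + ψ x • innerSL ℝ (a i)) x :=
        HasFDerivAt.mul ((innerSL ℝ (a i)).hasFDerivAt.const_add (c i))
          (hψ.differentiable (by simp) x).hasFDerivAt
      rw [hd1.fderiv]
      simp only [add_apply, smul_apply, smul_eq_mul, innerSL_apply_apply]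
      rw [show fderiv ℝ φ x w = ψ x from rfl]
      ring
    · refine Integrable.integrableOn (Continuous.integrable_of_hasCompactSupport ?_ ?_)
      · exact ((hl.mul hψ).continuous_fderiv (by simp)).clm_apply continuous_const
      · exact ((HasCompactSupport.mul_left hψc).fderiv (𝕜 := ℝ)).comp_left
          (g := fun A : E →L[ℝ] ℝ => A u) (by simp)
    · exact (hint2.const_mul _).integrableOn
  rw [hsplit, Finset.sum_congr rfl hcell, Finset.sum_add_distrib, Finset.sum_neg_distrib,
    sum_erase_eq_zero_of_antisymm, neg_zero, zero_add]
  -- Exchanging the two indices replaces `⟪a i, u⟫` by half the jump `⟪a i - a j, u⟫`.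
  · simp_rw [Finset.mul_sum]
    rw [← sub_eq_zero, ← Finset.sum_sub_distrib]
    simp_rw [← Finset.sum_sub_distrib]
    refine sum_erase_eq_zero_of_antisymm A _ fun i _ j _ _ => ?_
    rw [openFacet_comm j i, norm_sub_rev (a j) (a i)]
    simp only [inner_sub_left]
    ring
  -- The boundary terms with the undifferentiated affine functions cancel, by continuity of `F`.
  · intro i _ j _ _
    have : ∫ x in openFacet A c a i j, (c i + inner ℝ (a i) x) * ψ x ∂μHE[d] =
        ∫ x in openFacet A c a j i, (c j + inner ℝ (a j) x) * ψ x ∂μHE[d] := by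
      rw [openFacet_comm j i]
      refine setIntegral_congr_fun (measurableSet_openFacet i j) fun x hx => ?_
      simp only [(mem_openFacet.1 hx).1]
    rw [this, norm_sub_rev (a j) (a i)]
    simp only [inner_sub_left]
    ring

end MaxAffine

/-! ### Cells and facets of tropical polynomials -/

section HyperplaneMeasure
variable {E : Type*} [NormedAddCommGroup E] [InnerProductSpace ℝ E] [FiniteDimensional ℝ E]
  [MeasurableSpace E] [BorelSpace E]

theorem euclideanHausdorffMeasure_hyperplane_inter {d : ℕ} (hd : Module.finrank ℝ E = d + 1)
    {c₁ c₂ : ℝ} {v₁ v₂ : E} (hv : v₁ ≠ 0)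
    (h : ∃ x, c₁ + inner ℝ v₁ x = 0 ∧ c₂ + inner ℝ v₂ x ≠ 0) :
    (μHE[d] : Measure E) ({x | c₁ + inner ℝ v₁ x = 0} ∩ {x | c₂ + inner ℝ v₂ x = 0}) = 0 := by
  obtain ⟨p, hp, hp2⟩ := h
  have hm : MeasurableSet {x : E | c₂ + inner ℝ v₂ x = 0} :=
    (isClosed_eq (by fun_prop) continuous_const).measurableSet
  rw [Set.inter_comm, ← Measure.restrict_apply hm, ← map_volume_hyperplane hd hv hp,
    (measurableEmbedding_hyperplane v₁ p).map_apply]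
  convert volume_affine_zero_set (c₂ + inner ℝ v₂ p)
    ((innerSL ℝ v₂).comp (Submodule.subtypeL (Submodule.span ℝ {v₁})ᗮ)) ⟨0, by simpa using hp2⟩
    using 2
  ext y
  simp [inner_add_right, add_assoc]

theorem isLocallyFiniteMeasure_restrict_hyperplane {d : ℕ} (hd : Module.finrank ℝ E = d + 1)
    {v : E} (hv : v ≠ 0) (c : ℝ) :
    IsLocallyFiniteMeasure ((μHE[d] : Measure E).restrict {x | c + inner ℝ v x = 0}) := by
  obtain ⟨p, hp⟩ := exists_affine_eq_zero hv c
  rw [← map_volume_hyperplane hd hv hp]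
  refine ⟨fun x => ⟨Metric.ball x 1, Metric.ball_mem_nhds x one_pos, ?_⟩⟩
  rw [(measurableEmbedding_hyperplane v p).map_apply]
  refine Bornology.IsBounded.measure_lt_top ?_
  have hiso : Isometry (fun y : (Submodule.span ℝ {v})ᗮ => p + (y : E)) :=
    (IsometryEquiv.addLeft p).isometry.comp isometry_subtype_coe
  exact hiso.antilipschitz.isBounded_preimage Metric.isBounded_ball

end HyperplaneMeasure

section Tropical
variable {n : ℕ} {A : Finset (Fin n → ℤ)} {hA : A.Nonempty} {ν : (Fin n → ℤ) → ℝ}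

theorem intVec_injective : Function.Injective (intVec (n := n)) := by
  intro a b h
  funext i
  have := congrArg (fun y : RSpace n => y i) h
  simpa [intVec] using this

theorem facetNormal_eq_sub (a b : Fin n → ℤ) : facetNormal a b = intVec a - intVec b := by
  ext i
  simp [facetNormal, intVec]

theorem continuous_tropMonomial (a : Fin n → ℤ) : Continuous (tropMonomial ν a) := by
  unfold tropMonomial
  fun_prop

theorem continuous_tropPoly : Continuous (tropPoly A hA ν) := by
  have := Continuous.finset_sup'_apply hA (f := fun a x => tropMonomial ν a x)
    fun a _ => continuous_tropMonomial a
  exact this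

theorem tropMonomial_le_tropPoly {a : Fin n → ℤ} (ha : a ∈ A) (x : RSpace n) :
    tropMonomial ν a x ≤ tropPoly A hA ν x :=
  Finset.le_sup' (fun a => tropMonomial ν a x) ha

theorem tropPoly_eq_of_mem_openCell {a : Fin n → ℤ} (ha : a ∈ A) {x : RSpace n}
    (hx : x ∈ openCell A (fun k => -ν k) intVec a) : tropPoly A hA ν x = tropMonomial ν a x := by
  refine le_antisymm (Finset.sup'_le hA _ fun b hb => ?_) (tropMonomial_le_tropPoly ha x)
  by_cases hba : b = a
  · rw [hba]
  · exact (mem_openCell.1 hx b hb hba).le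

/-- Almost every point lies on no hyperplane where two monomials agree, so that exactly one monomial
realizes the maximum there. -/
theorem ae_exists_mem_openCell (hA : A.Nonempty) :
    ∀ᵐ x : RSpace n, ∃ a ∈ A, x ∈ openCell A (fun k => -ν k) intVec a := by
  have hne : ∀ᵐ x : RSpace n, ∀ a ∈ A, ∀ b ∈ A, a ≠ b →
      tropMonomial ν a x ≠ tropMonomial ν b x := by
    refine (eventually_all_finset A).2 fun a _ => (eventually_all_finset A).2 fun b _ => ?_
    by_cases hab : a = b
    · simp [hab]
    have hv : intVec a - intVec b ≠ 0 := sub_ne_zero.2 (intVec_injective.ne hab)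
    have := volume_affine_zero_set (-ν a + ν b) (innerSL ℝ (intVec a - intVec b)) (by
      refine ⟨((1 - (-ν a + ν b)) / ‖intVec a - intVec b‖ ^ 2) • (intVec a - intVec b), ?_⟩
      have hn : ‖intVec a - intVec b‖ ≠ 0 := norm_ne_zero_iff.2 hv
      rw [map_smul, innerSL_apply_apply, real_inner_self_eq_norm_sq, smul_eq_mul]
      field_simp
      simp)
    refine measure_mono_null (fun x hx => ?_) this
    simp only [Set.mem_compl_iff, Set.mem_ofPred_eq, not_forall, not_not] at hx
    obtain ⟨_, hx⟩ := hx
    simp only [tropMonomial] at hx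
    simp only [Set.mem_ofPred_eq, innerSL_apply_apply, inner_sub_left]
    linarith
  filter_upwards [hne] with x hx
  obtain ⟨a, ha, hmax⟩ := Finset.exists_max_image A (fun a => tropMonomial ν a x) hA
  refine ⟨a, ha, mem_openCell.2 fun b hb hba => ?_⟩
  exact lt_of_le_of_ne (hmax b hb) (hx b hb a ha hba)

open Classical in
/-- The exponents of the monomials which realize the maximum on an `n`-dimensional set. -/
noncomputable def essentialExponents (A : Finset (Fin n → ℤ)) (hA : A.Nonempty)
    (ν : (Fin n → ℤ) → ℝ) : Finset (Fin n → ℤ) :=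
  A.filter fun a => (interior (tropCell A hA ν a)).Nonempty

theorem mem_essentialExponents {a : Fin n → ℤ} : a ∈ essentialExponents A hA ν ↔
    a ∈ A ∧ (interior (tropCell A hA ν a)).Nonempty := by
  simp [essentialExponents]

theorem mem_essentialExponents_iff_openCell {a : Fin n → ℤ} (ha : a ∈ A) :
    a ∈ essentialExponents A hA ν ↔ (openCell A (fun k => -ν k) intVec a).Nonempty := by
  rw [mem_essentialExponents]
  constructor
  · rintro ⟨-, hne⟩
    obtain ⟨x, hxi, b, hb, hx⟩ := (Measure.dense_of_ae
      (ae_exists_mem_openCell (ν := ν) hA)).inter_open_nonempty _ isOpen_interior hne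
    have hxa : x ∈ tropCell A hA ν a := interior_subset hxi
    have hxa : tropMonomial ν a x = tropPoly A hA ν x := hxa
    rw [tropPoly_eq_of_mem_openCell hb hx] at hxa
    have : a = b := by
      by_contra hab
      exact (mem_openCell.1 hx a ha hab).ne hxa
    exact ⟨x, this ▸ hx⟩
  · refine fun hne => ⟨ha, hne.mono ?_⟩
    refine interior_maximal (fun x hx => (tropPoly_eq_of_mem_openCell ha hx).symm) ?_
    exact isOpen_affine_pos _ (fun j => -ν a - -ν j) fun j => intVec a - intVec j

theorem ae_exists_essential : ∀ᵐ x : RSpace n, ∃ a ∈ essentialExponents A hA ν,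
    x ∈ openCell (essentialExponents A hA ν) (fun k => -ν k) intVec a ∧
      tropPoly A hA ν x = -ν a + inner ℝ (intVec a) x := by
  filter_upwards [ae_exists_mem_openCell (ν := ν) hA] with x hx
  obtain ⟨a, ha, hx⟩ := hx
  exact ⟨a, (mem_essentialExponents_iff_openCell ha).2 ⟨x, hx⟩,
    mem_openCell.2 fun b hb hba => mem_openCell.1 hx b (mem_essentialExponents.1 hb).1 hba,
    tropPoly_eq_of_mem_openCell ha hx⟩

theorem irredundant_essentialExponents :
    Irredundant (essentialExponents A hA ν) (fun k => -ν k) intVec := by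
  intro a ha
  obtain ⟨x, hx⟩ := (mem_essentialExponents_iff_openCell (mem_essentialExponents.1 ha).1).1 ha
  exact ⟨x, mem_openCell.2 fun b hb hba => mem_openCell.1 hx b (mem_essentialExponents.1 hb).1 hba⟩

/-- The essential exponents suffice to compute the tropical polynomial, at every point. -/
theorem exists_essential_eq (x : RSpace n) :
    ∃ a ∈ essentialExponents A hA ν, tropPoly A hA ν x = tropMonomial ν a x := by
  have hcl : IsClosed {x | ∃ a ∈ essentialExponents A hA ν,
      tropPoly A hA ν x = tropMonomial ν a x} := by
    have : {x | ∃ a ∈ essentialExponents A hA ν, tropPoly A hA ν x = tropMonomial ν a x} =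
        ⋃ a ∈ essentialExponents A hA ν, {x | tropPoly A hA ν x = tropMonomial ν a x} := by
      ext; simp
    rw [this]
    exact isClosed_biUnion_finset fun a _ =>
      isClosed_eq continuous_tropPoly (continuous_tropMonomial a)
  have hdense : Dense {x | ∃ a ∈ essentialExponents A hA ν,
      tropPoly A hA ν x = tropMonomial ν a x} := by
    refine Measure.dense_of_ae (μ := volume) ?_
    filter_upwards [ae_exists_essential (A := A) (hA := hA) (ν := ν)] with x hx
    obtain ⟨a, ha, -, h⟩ := hx
    exact ⟨a, ha, h⟩
  have : x ∈ closure {x | ∃ a ∈ essentialExponents A hA ν,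
    tropPoly A hA ν x = tropMonomial ν a x} := hdense x
  rwa [hcl.closure_eq] at this

/-- Two different monomials cannot both realize the maximum at a point where `f` is smooth: the
derivative of `f` would be equal to both exponents. -/
theorem mem_tropHypersurface_of_mem_tropCell {a b : Fin n → ℤ} (ha : a ∈ A) (hb : b ∈ A)
    (hab : a ≠ b) {x : RSpace n} (hxa : x ∈ tropCell A hA ν a) (hxb : x ∈ tropCell A hA ν b) :
    x ∈ tropHypersurface A hA ν := by
  intro hsm
  have hdiff : DifferentiableAt ℝ (tropPoly A hA ν) x := hsm.differentiableAt (by simp)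
  have key : ∀ k ∈ A, x ∈ tropCell A hA ν k →
      fderiv ℝ (tropPoly A hA ν) x = innerSL ℝ (intVec k) := by
    intro k hk hxk
    have hxk : tropMonomial ν k x = tropPoly A hA ν x := hxk
    have hmon : HasFDerivAt (tropMonomial ν k) (innerSL ℝ (intVec k)) x :=
      ((innerSL ℝ (intVec k)).hasFDerivAt).const_add (-ν k)
    have hmin : IsLocalMin (fun y => tropPoly A hA ν y - tropMonomial ν k y) x := by
      refine Eventually.of_forall fun y => ?_
      have := tropMonomial_le_tropPoly (hA := hA) (ν := ν) hk y
      simp only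
      linarith
    exact sub_eq_zero.1 (hmin.hasFDerivAt_eq_zero (hdiff.hasFDerivAt.sub hmon))
  have := (key a ha hxa).symm.trans (key b hb hxb)
  refine hab (intVec_injective ?_)
  exact (innerSL ℝ).toLinearMap.ker_eq_bot.1 (by
    rw [LinearMap.ker_eq_bot']
    intro z hz
    have := congrArg (fun f : RSpace n →L[ℝ] ℝ => f z) hz
    simpa using this) this

theorem tropFacet_comm (a b : Fin n → ℤ) : tropFacet A hA ν a b = tropFacet A hA ν b a := by
  simp only [tropFacet, Set.inter_comm (tropCell A hA ν a)]

theorem IsFacetPair.symm {a b : Fin n → ℤ} (h : IsFacetPair A hA ν a b) :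
    IsFacetPair A hA ν b a where
  left_mem := h.right_mem
  right_mem := h.left_mem
  ne := h.ne.symm
  left_cell := h.right_cell
  right_cell := h.left_cell
  nonempty := by rw [tropFacet_comm]; exact h.nonempty
  dim_eq := by rw [tropFacet_comm]; exact h.dim_eq

theorem openFacet_subset_tropFacet {a b : Fin n → ℤ} (ha : a ∈ essentialExponents A hA ν)
    (hb : b ∈ essentialExponents A hA ν) (hab : a ≠ b) :
    openFacet (essentialExponents A hA ν) (fun k => -ν k) intVec a b ⊆ tropFacet A hA ν a b := by
  intro x hx
  obtain ⟨h1, h2⟩ := mem_openFacet.1 hx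
  have h1 : tropMonomial ν a x = tropMonomial ν b x := h1
  have hxa : tropMonomial ν a x = tropPoly A hA ν x := by
    obtain ⟨k, hk, hxk⟩ := exists_essential_eq (A := A) (hA := hA) (ν := ν) x
    by_cases hka : k = a
    · rw [hxk, hka]
    by_cases hkb : k = b
    · rw [hxk, hkb, h1]
    have := h2 k hk hka hkb
    have h3 := tropMonomial_le_tropPoly (hA := hA) (ν := ν) (mem_essentialExponents.1 ha).1 x
    rw [hxk] at h3
    exact absurd h3 (not_le.2 this)
  have hxb : x ∈ tropCell A hA ν b := h1.symm.trans hxa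
  exact ⟨mem_tropHypersurface_of_mem_tropCell (mem_essentialExponents.1 ha).1
    (mem_essentialExponents.1 hb).1 hab hxa hxb, hxa, hxb⟩

theorem tropFacet_subset_hyperplane (a b : Fin n → ℤ) : tropFacet A hA ν a b ⊆
    {x | (-ν a - -ν b) + inner ℝ (intVec a - intVec b) x = 0} := by
  rintro x ⟨-, hxa, hxb⟩
  have : tropMonomial ν a x = tropMonomial ν b x := Eq.trans hxa (Eq.symm hxb)
  simp only [tropMonomial] at this
  simp only [Set.mem_ofPred_eq, inner_sub_left]
  linarith

end Tropical

section TropicalFacets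
variable {m : ℕ} {A : Finset (Fin (m + 1) → ℤ)} {hA : A.Nonempty} {ν : (Fin (m + 1) → ℤ) → ℝ}

/-- A facet differs from the corresponding open facet by points where a third essential monomial
realizes the maximum; they lie on finitely many affine subspaces of dimension `m - 1`. -/
theorem openFacet_ae_eq_tropFacet {a b : Fin (m + 1) → ℤ} (ha : a ∈ essentialExponents A hA ν)
    (hb : b ∈ essentialExponents A hA ν) (hab : a ≠ b) :
    openFacet (essentialExponents A hA ν) (fun k => -ν k) intVec a b =ᵐ[μHE[m]]
      tropFacet A hA ν a b := by
  refine (openFacet_subset_tropFacet ha hb hab).eventuallyLE.antisymm ?_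
  rw [ae_le_set]
  have hirr := irredundant_essentialExponents (A := A) (hA := hA) (ν := ν)
  refine measure_mono_null (t := ⋃ k ∈ ((essentialExponents A hA ν).erase a).erase b,
    ({x : RSpace (m + 1) | (-ν a - -ν b) + inner ℝ (intVec a - intVec b) x = 0} ∩
      {x | (-ν a - -ν k) + inner ℝ (intVec a - intVec k) x = 0})) ?_ ?_
  · rintro x ⟨hx, hx'⟩
    have hH := tropFacet_subset_hyperplane a b hx
    simp only [openFacet, Set.mem_inter_iff, not_and] at hx'
    have h1 := hx' hH
    simp only [Set.mem_ofPred_eq, not_forall] at h1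
    obtain ⟨k, hk, hle⟩ := h1
    refine Set.mem_biUnion hk ⟨hH, ?_⟩
    refine le_antisymm (not_lt.1 hle) ?_
    have hk' : k ∈ A :=
      (mem_essentialExponents.1 (Finset.mem_of_mem_erase (Finset.mem_of_mem_erase hk))).1
    have h2 := tropMonomial_le_tropPoly (hA := hA) (ν := ν) hk' x
    rw [← show tropMonomial ν a x = tropPoly A hA ν x from hx.2.1] at h2
    simp only [tropMonomial] at h2
    rw [inner_sub_left]
    linarith
  · refine (measure_biUnion_null_iff (Finset.countable_toSet _)).2 fun k hk => ?_
    have hk : k ∈ ((essentialExponents A hA ν).erase a).erase b := hk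
    simp only [Finset.mem_erase] at hk
    exact euclideanHausdorffMeasure_hyperplane_inter finrank_euclideanSpace_fin
      (hirr.slope_sub_ne_zero ha hb hab)
      (hirr.exists_ne ha hb hk.2.2 hab hk.2.1.symm hk.1.symm)

/-- Pairs of essential exponents which are not facet pairs have an empty open facet, and so do not
contribute to the second derivatives of the tropical polynomial. -/
theorem isFacetPair_of_openFacet_nonempty {a b : Fin (m + 1) → ℤ}
    (ha : a ∈ essentialExponents A hA ν) (hb : b ∈ essentialExponents A hA ν) (hab : a ≠ b)
    (hne : (openFacet (essentialExponents A hA ν) (fun k => -ν k) intVec a b).Nonempty) :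
    IsFacetPair A hA ν a b where
  left_mem := (mem_essentialExponents.1 ha).1
  right_mem := (mem_essentialExponents.1 hb).1
  ne := hab
  left_cell := (mem_essentialExponents.1 ha).2
  right_cell := (mem_essentialExponents.1 hb).2
  nonempty := hne.mono (openFacet_subset_tropFacet ha hb hab)
  dim_eq := by
    have hv : intVec a - intVec b ≠ 0 := sub_ne_zero.2 (intVec_injective.ne hab)
    -- The affine hull of the facet is the whole hyperplane, as the open facet is open in it.
    have hspan : vectorSpan ℝ (tropFacet A hA ν a b) =
        (Submodule.span ℝ {intVec a - intVec b})ᗮ := by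
      apply le_antisymm
      · rw [vectorSpan_def, Submodule.span_le]
        rintro z ⟨x, hx, y, hy, rfl⟩
        refine Submodule.mem_orthogonal_singleton_iff_inner_right.2 ?_
        have h1 : _ = (0 : ℝ) := tropFacet_subset_hyperplane a b hx
        have h2 : _ = (0 : ℝ) := tropFacet_subset_hyperplane a b hy
        simp only [vsub_eq_sub, inner_sub_right]
        linarith
      · intro z hz
        have hz := Submodule.mem_orthogonal_singleton_iff_inner_right.1 hz
        obtain ⟨x, hx⟩ := hne
        have hopen := (isOpen_affine_pos (((essentialExponents A hA ν).erase a).erase b)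
          (fun k => -ν a - -ν k) (fun k => intVec a - intVec k)).preimage
          (by fun_prop : Continuous fun t : ℝ => x + t • z)
        have h0 : ∀ᶠ t in 𝓝[>] (0 : ℝ), t ∈ (fun t : ℝ => x + t • z) ⁻¹'
            {x | ∀ k ∈ ((essentialExponents A hA ν).erase a).erase b,
              0 < -ν a - -ν k + inner ℝ (intVec a - intVec k) x} :=
          nhdsWithin_le_nhds (hopen.mem_nhds (by simpa using hx.2))
        obtain ⟨t, ht, htpos⟩ := (h0.and self_mem_nhdsWithin).exists
        have htpos : 0 < t := htpos
        have hmem : x + t • z ∈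
            openFacet (essentialExponents A hA ν) (fun k => -ν k) intVec a b := by
          refine ⟨?_, ht⟩
          have : _ = (0 : ℝ) := hx.1
          simp only [Set.mem_ofPred_eq, inner_add_right, inner_smul_right, hz]
          linarith
        have h3 := vsub_mem_vectorSpan ℝ (openFacet_subset_tropFacet ha hb hab hmem)
          (openFacet_subset_tropFacet ha hb hab hx)
        have h4 := Submodule.smul_mem _ t⁻¹ h3
        simpa [smul_smul, htpos.ne'] using h4
    have : Fact (Module.finrank ℝ (RSpace (m + 1)) = m + 1) := ⟨finrank_euclideanSpace_fin⟩
    rw [hspan, Submodule.finrank_orthogonal_span_singleton (n := m) hv]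

/-- A sum over a list of the facets, against all ordered pairs of essential exponents: every facet
comes from two ordered pairs, and the other pairs do not contribute. -/
theorem sum_facetList_eq {ι : Type*} [Fintype ι] {a b : ι → Fin (m + 1) → ℤ}
    (hF : IsFacetList A hA ν a b) (g : (Fin (m + 1) → ℤ) → (Fin (m + 1) → ℤ) → ℝ)
    (hsymm : ∀ k l, g k l = g l k)
    (hzero : ∀ k ∈ essentialExponents A hA ν, ∀ l ∈ essentialExponents A hA ν, k ≠ l →
      ¬ IsFacetPair A hA ν k l → g k l = 0) :
    1 / 2 * ∑ k ∈ essentialExponents A hA ν, ∑ l ∈ (essentialExponents A hA ν).erase k, g k l =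
      ∑ i, g (a i) (b i) := by
  classical
  set S := (essentialExponents A hA ν ×ˢ essentialExponents A hA ν).filter
    fun p => IsFacetPair A hA ν p.1 p.2 with hS
  have hmemS : ∀ k l, (k, l) ∈ S ↔ IsFacetPair A hA ν k l := by
    intro k l
    simp only [hS, Finset.mem_filter, Finset.mem_product, mem_essentialExponents]
    exact ⟨fun h => h.2, fun h => ⟨⟨⟨h.left_mem, h.left_cell⟩, h.right_mem, h.right_cell⟩, h⟩⟩
  have h1 : ∑ k ∈ essentialExponents A hA ν, ∑ l ∈ (essentialExponents A hA ν).erase k, g k l =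
      ∑ p ∈ S, g p.1 p.2 := by
    rw [hS, Finset.sum_filter, Finset.sum_product]
    refine Finset.sum_congr rfl fun k hk => ?_
    rw [← Finset.add_sum_erase _ _ hk, if_neg fun h : IsFacetPair A hA ν k k => h.ne rfl, zero_add]
    refine Finset.sum_congr rfl fun l hl => ?_
    rw [Finset.mem_erase] at hl
    split_ifs with h
    · rfl
    · exact hzero k hk l hl.2 hl.1.symm h
  have h2 : ∑ p ∈ S, g p.1 p.2 = ∑ q : ι × Bool, g (a q.1) (b q.1) := by
    symm
    refine Finset.sum_nbij
      (fun q => if q.2 then (a q.1, b q.1) else (b q.1, a q.1)) ?_ ?_ ?_ ?_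
    · rintro ⟨i, _ | _⟩ -
      · exact (hmemS _ _).2 (hF.isFacetPair i).symm
      · exact (hmemS _ _).2 (hF.isFacetPair i)
    · rintro ⟨i, s⟩ - ⟨j, t⟩ - heq
      have hij : i = j := by
        refine (hF.existsUnique _ _ (hF.isFacetPair j)).unique ?_ (Or.inl ⟨rfl, rfl⟩)
        cases s <;> cases t <;> simp at heq <;> tauto
      subst hij
      have hne := (hF.isFacetPair i).ne
      cases s <;> cases t <;> simp at heq
      · rfl
      · exact absurd heq.2 hne
      · exact absurd heq.1 hne
      · rfl
    · rintro ⟨k, l⟩ hkl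
      obtain ⟨i, hi, -⟩ := hF.existsUnique k l ((hmemS k l).1 hkl)
      rcases hi with ⟨rfl, rfl⟩ | ⟨rfl, rfl⟩
      · exact ⟨(i, true), by simp, by simp⟩
      · exact ⟨(i, false), by simp, by simp⟩
    · rintro ⟨i, _ | _⟩ -
      · exact hsymm _ _
      · rfl
  rw [h1, h2, Fintype.sum_prod_type]
  simp only [Fintype.sum_bool]
  rw [Finset.sum_add_distrib]
  ring

/-- The second distributional derivatives of a tropical polynomial are carried by its facets, with
density `⟪v, u⟫ ⟪v, w⟫ / ‖v‖` on a facet with normal vector `v`. -/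
theorem integral_tropPoly_mul_fderiv_fderiv {ι : Type*} [Fintype ι] {a b : ι → Fin (m + 1) → ℤ}
    (hF : IsFacetList A hA ν a b) {φ : RSpace (m + 1) → ℝ} (hφ : ContDiff ℝ 2 φ)
    (hφc : HasCompactSupport φ) (u w : RSpace (m + 1)) :
    ∫ x, tropPoly A hA ν x * fderiv ℝ (fun y => fderiv ℝ φ y w) x u =
      ∑ i, inner ℝ (facetNormal (a i) (b i)) u * inner ℝ (facetNormal (a i) (b i)) w /
        ‖facetNormal (a i) (b i)‖ * ∫ x in tropFacet A hA ν (a i) (b i), φ x ∂μHE[m] := by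
  rw [integral_max_affine_mul_fderiv_fderiv finrank_euclideanSpace_fin
    irredundant_essentialExponents ae_exists_essential hφ hφc u w]
  rw [sum_facetList_eq hF]
  · refine Finset.sum_congr rfl fun i _ => ?_
    have hi := hF.isFacetPair i
    rw [facetNormal_eq_sub, Measure.restrict_congr_set (openFacet_ae_eq_tropFacet
      (mem_essentialExponents.2 ⟨hi.left_mem, hi.left_cell⟩)
      (mem_essentialExponents.2 ⟨hi.right_mem, hi.right_cell⟩) hi.ne)]
  · intro k l
    rw [openFacet_comm k l, norm_sub_rev (intVec k)]
    simp only [inner_sub_left]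
    ring
  · intro k hk l hl hkl hnot
    have : openFacet (essentialExponents A hA ν) (fun k => -ν k) intVec k l = ∅ := by
      by_contra hne
      exact hnot (isFacetPair_of_openFacet_nonempty hk hl hkl (Set.nonempty_iff_ne_empty.2 hne))
    rw [this]
    simp

theorem IsFacetPair.locallyIntegrable_one {a b : Fin (m + 1) → ℤ} (h : IsFacetPair A hA ν a b) :
    LocallyIntegrable (fun _ : RSpace (m + 1) => (1 : ℝ))
      ((μHE[m] : Measure (RSpace (m + 1))).restrict (tropFacet A hA ν a b)) := by
  have := isLocallyFiniteMeasure_restrict_hyperplane (E := RSpace (m + 1)) (d := m)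
    finrank_euclideanSpace_fin
    (sub_ne_zero.2 (intVec_injective.ne h.ne)) (-ν a - -ν b)
  exact LocallyIntegrable.mono_measure (locallyIntegrable_const 1)
    (Measure.restrict_mono_set _ (tropFacet_subset_hyperplane a b))

end TropicalFacets

/-! ### Evaluation of super forms on frames -/

section FormEvaluation
variable {n k p q : ℕ}

/-- The scalar function `x ↦ α x w` obtained by evaluating a test form on a fixed family `w`. -/
noncomputable def evalAt (α : TestForm n k p q) (w : Fin k → RSpace n × RSpace n)
    (x : RSpace n) : ℝ :=
  BiForm.incl n k p q (α x) w

theorem contDiff_evalAt (α : TestForm n k p q) (w : Fin k → RSpace n × RSpace n) :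
    ContDiff ℝ ∞ (evalAt α w) :=
  (evalFrame w α).contDiff

theorem hasCompactSupport_evalAt (α : TestForm n k p q) (w : Fin k → RSpace n × RSpace n) :
    HasCompactSupport (evalAt α w) :=
  (evalFrame w α).hasCompactSupport

theorem fderiv_evalAt (α : TestForm n k p q) (w : Fin k → RSpace n × RSpace n) (x u : RSpace n) :
    fderiv ℝ (evalAt α w) x u = BiForm.incl n k p q (fderiv ℝ α x u) w := by
  have hα : HasFDerivAt (α : RSpace n → BiForm n k p q) (fderiv ℝ α x) x :=
    (α.contDiff.differentiable (by simp)).differentiableAt.hasFDerivAt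
  have := (((ContinuousAlternatingMap.apply ℝ (RSpace n × RSpace n) ℝ w).comp
    (BiForm.incl n k p q)).hasFDerivAt).comp x hα
  exact congrArg (fun A : RSpace n →L[ℝ] ℝ => A u) this.fderiv

theorem evalAt_formD (α : TestForm n k p q) (w : Fin (k + 1) → RSpace n × RSpace n)
    (x : RSpace n) : evalAt (formD n k p q α) w x =
      ∑ i : Fin (k + 1), (-1 : ℝ) ^ (i : ℕ) * fderiv ℝ (evalAt α (i.removeNth w)) x (w i).1 := by
  have : evalAt (formD n k p q α) w x = ContinuousAlternatingMap.alternatizeUncurryFin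
      ((BiForm.incl n k p q).comp ((fderiv ℝ α x).comp
        (ContinuousLinearMap.fst ℝ (RSpace n) (RSpace n)))) w := by
    simp only [evalAt, formD, ContinuousLinearMap.comp_apply, TestFunction.postcompCLM_apply,
      Function.comp_apply, TestFunction.fderivCLM_apply]
    rfl
  rw [this, ContinuousAlternatingMap.alternatizeUncurryFin_apply]
  refine Finset.sum_congr rfl fun i _ => ?_
  rw [fderiv_evalAt]
  simp

theorem evalAt_formDSharp (α : TestForm n k p q) (w : Fin (k + 1) → RSpace n × RSpace n)
    (x : RSpace n) : evalAt (formDSharp n k p q α) w x =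
      ∑ i : Fin (k + 1), (-1 : ℝ) ^ (i : ℕ) * fderiv ℝ (evalAt α (i.removeNth w)) x (w i).2 := by
  have : evalAt (formDSharp n k p q α) w x =
      evalAt (formD n k q p (formJ n k p q α)) (fun i => swapJ n (w i)) x := rfl
  rw [this, evalAt_formD]
  rfl

theorem evalAt_wedge (θ : (RSpace n × RSpace n) →L[ℝ] ℝ) (hθ : ∀ x, θ (x, 0) = 0)
    (α : TestForm n k p q) (w : Fin (k + 1) → RSpace n × RSpace n) (x : RSpace n) :
    evalAt (TestFunction.postcompCLM (wedgePoint n k p q θ hθ) α) w x =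
      ∑ i : Fin (k + 1), (-1 : ℝ) ^ (i : ℕ) * (θ (w i) * evalAt α (i.removeNth w) x) := by
  have : evalAt (TestFunction.postcompCLM (wedgePoint n k p q θ hθ) α) w x =
      ContinuousAlternatingMap.alternatizeUncurryFin
      (θ.smulRight (BiForm.incl n k p q (α x))) w := rfl
  rw [this, ContinuousAlternatingMap.alternatizeUncurryFin_apply]
  refine Finset.sum_congr rfl fun i _ => ?_
  simp [evalAt]

end FormEvaluation

section SuperFrame
variable {n r s k : ℕ}

theorem superFrame_of_lt (h : k = r + s) (e : Fin r → RSpace n) (ε : Fin s → RSpace n) (i : Fin k)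
    (hi : (i : ℕ) < r) : superFrame h e ε i = (e ⟨i, hi⟩, 0) := by
  have : Fin.cast h i = Fin.castAdd s ⟨i, hi⟩ := rfl
  rw [superFrame, this, Fin.append_left]

theorem superFrame_of_ge (h : k = r + s) (e : Fin r → RSpace n) (ε : Fin s → RSpace n) (i : Fin k)
    (hi : r ≤ (i : ℕ)) : superFrame h e ε i = (0, ε ⟨i - r, by omega⟩) := by
  have : Fin.cast h i = Fin.natAdd r ⟨i - r, by omega⟩ := by
    ext; simp; omega
  rw [superFrame, this, Fin.append_right]

theorem superFrame_mk_left (h : k = r + s) (e : Fin r → RSpace n) (ε : Fin s → RSpace n)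
    (i : Fin r) (hi : (i : ℕ) < k) : superFrame h e ε ⟨i, hi⟩ = (e i, 0) :=
  superFrame_of_lt h e ε ⟨i, hi⟩ i.2

theorem superFrame_mk_right (h : k = r + s) (e : Fin r → RSpace n) (ε : Fin s → RSpace n)
    (j : Fin s) (hj : r + (j : ℕ) < k) : superFrame h e ε ⟨r + j, hj⟩ = (0, ε j) := by
  rw [superFrame_of_ge h e ε ⟨r + j, hj⟩ (Nat.le_add_right _ _)]
  simp

theorem val_succAbove_eq_ite (i : Fin (k + 1)) (j : Fin k) :
    ((i.succAbove j : Fin (k + 1)) : ℕ) = if (j : ℕ) < i then (j : ℕ) else j + 1 := by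
  simp only [Fin.succAbove, Fin.lt_def, Fin.val_castSucc]
  split_ifs <;> simp

/-- Omitting a vector of the first factor from a super frame. -/
theorem removeNth_superFrame_left (h : k + 1 = (r + 1) + s) (e : Fin (r + 1) → RSpace n)
    (ε : Fin s → RSpace n) (i : Fin (k + 1)) (hi : (i : ℕ) < r + 1) :
    i.removeNth (superFrame h e ε) =
      superFrame (by omega : k = r + s) (Fin.removeNth ⟨i, hi⟩ e) ε := by
  funext j
  rw [Fin.removeNth_apply]
  by_cases hj : (j : ℕ) < r
  · rw [superFrame_of_lt _ _ _ j hj]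
    have hlt : ((i.succAbove j : Fin (k + 1)) : ℕ) < r + 1 := by
      rw [val_succAbove_eq_ite]; split_ifs <;> omega
    rw [superFrame_of_lt _ _ _ _ hlt, Fin.removeNth_apply]
    congr 2
    ext
    simp [val_succAbove_eq_ite]
  · rw [superFrame_of_ge _ _ _ j (by omega)]
    have hv : ((i.succAbove j : Fin (k + 1)) : ℕ) = j + 1 := by
      rw [val_succAbove_eq_ite, if_neg (by omega)]
    rw [superFrame_of_ge _ _ _ _ (by omega)]
    congr 3
    omega

/-- Omitting a vector of the second factor from a super frame. -/
theorem removeNth_superFrame_right (h : k + 1 = r + (s + 1)) (e : Fin r → RSpace n)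
    (ε : Fin (s + 1) → RSpace n) (i : Fin (k + 1)) (hi : r ≤ (i : ℕ)) :
    i.removeNth (superFrame h e ε) =
      superFrame (by omega : k = r + s) e (Fin.removeNth ⟨i - r, by omega⟩ ε) := by
  funext j
  rw [Fin.removeNth_apply]
  by_cases hj : (j : ℕ) < r
  · rw [superFrame_of_lt _ _ _ j hj]
    have hv : ((i.succAbove j : Fin (k + 1)) : ℕ) = j := by
      rw [val_succAbove_eq_ite, if_pos (by omega)]
    rw [superFrame_of_lt _ _ _ _ (by omega)]
    congr 3
  · rw [superFrame_of_ge _ _ _ j (by omega)]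
    have hge : r ≤ ((i.succAbove j : Fin (k + 1)) : ℕ) := by
      rw [val_succAbove_eq_ite]; split_ifs <;> omega
    rw [superFrame_of_ge _ _ _ _ hge, Fin.removeNth_apply]
    congr 2
    ext
    simp only [val_succAbove_eq_ite]
    split_ifs <;> omega

theorem sum_fin_eq_add (h : k = r + s) (f : Fin k → ℝ) :
    ∑ i, f i = ∑ i : Fin r, f ⟨i, by omega⟩ + ∑ j : Fin s, f ⟨r + j, by omega⟩ := by
  subst h
  rw [Fin.sum_univ_add]
  rfl

/-- An alternating sum over a super frame of terms which vanish on the second factor. -/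
theorem sum_superFrame_left (h : k + 1 = (r + 1) + s) (e : Fin (r + 1) → RSpace n)
    (ε : Fin s → RSpace n)
    (F : RSpace n × RSpace n → (Fin k → RSpace n × RSpace n) → ℝ) (hF : ∀ y w, F (0, y) w = 0) :
    ∑ i : Fin (k + 1), (-1 : ℝ) ^ (i : ℕ) *
      F (superFrame h e ε i) (i.removeNth (superFrame h e ε)) =
      ∑ i : Fin (r + 1), (-1 : ℝ) ^ (i : ℕ) *
        F (e i, 0) (superFrame (by omega) (i.removeNth e) ε) := by
  rw [sum_fin_eq_add h]
  have : ∀ j : Fin s, superFrame h e ε ⟨(r + 1) + j, by omega⟩ = (0, ε j) :=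
    fun j => superFrame_mk_right h e ε j _
  simp only [this, hF, mul_zero, Finset.sum_const_zero, add_zero]
  refine Finset.sum_congr rfl fun i _ => ?_
  rw [superFrame_mk_left, removeNth_superFrame_left h e ε ⟨i, _⟩ i.2]

/-- An alternating sum over a super frame of terms which vanish on the first factor. -/
theorem sum_superFrame_right (h : k + 1 = r + (s + 1)) (e : Fin r → RSpace n)
    (ε : Fin (s + 1) → RSpace n)
    (F : RSpace n × RSpace n → (Fin k → RSpace n × RSpace n) → ℝ) (hF : ∀ y w, F (y, 0) w = 0) :
    ∑ i : Fin (k + 1), (-1 : ℝ) ^ (i : ℕ) *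
      F (superFrame h e ε i) (i.removeNth (superFrame h e ε)) =
      ∑ j : Fin (s + 1), (-1 : ℝ) ^ (r + j : ℕ) *
        F (0, ε j) (superFrame (by omega) e (j.removeNth ε)) := by
  rw [sum_fin_eq_add h]
  have : ∀ i : Fin r, superFrame h e ε ⟨i, by omega⟩ = (e i, 0) :=
    fun i => superFrame_mk_left h e ε i _
  simp only [this, hF, mul_zero, Finset.sum_const_zero, zero_add]
  refine Finset.sum_congr rfl fun j _ => ?_
  rw [superFrame_mk_right,
    removeNth_superFrame_right h e ε ⟨r + j, _⟩ (Nat.le_add_right r (j : ℕ))]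
  simp

theorem superFrame_update [DecidableEq (Fin r)] [DecidableEq (Fin k)] (h : k = r + s)
    (e : Fin r → RSpace n) (ε : Fin s → RSpace n) (i : Fin r) (x : RSpace n) :
    superFrame h (Function.update e i x) ε =
      Function.update (superFrame h e ε) ⟨i, by omega⟩ (x, 0) := by
  funext j
  by_cases hj : (j : ℕ) < r
  · rw [superFrame_of_lt _ _ _ j hj]
    by_cases hij : (⟨j, hj⟩ : Fin r) = i
    · subst hij
      simp
    · have : j ≠ ⟨i, by omega⟩ := fun h' => hij (by ext; simp [h'])
      rw [Function.update_of_ne hij, Function.update_of_ne this, superFrame_of_lt _ _ _ j hj]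
  · rw [superFrame_of_ge _ _ _ j (by omega)]
    have : j ≠ ⟨i, by omega⟩ := fun h' => hj (by simp [h'])
    rw [Function.update_of_ne this, superFrame_of_ge _ _ _ j (by omega)]

/-- The alternating form in the first `r` vectors obtained from a form on `ℝⁿ × ℝⁿ` by fixing the
remaining ones in the second factor. -/
noncomputable def partialForm (h : k = r + s) (β : (RSpace n × RSpace n) [⋀^Fin k]→L[ℝ] ℝ)
    (ε : Fin s → RSpace n) : RSpace n [⋀^Fin r]→ₗ[ℝ] ℝ where
  toFun e := β (superFrame h e ε)
  map_update_add' e i x y := by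
    classical
    simp only [superFrame_update]
    rw [← β.map_update_add]
    simp
  map_update_smul' e i c x := by
    classical
    simp only [superFrame_update]
    rw [← β.map_update_smul]
    simp
  map_eq_zero_of_eq' e i j hij hne := by
    refine β.map_eq_zero_of_eq _ (i := ⟨i, by omega⟩) (j := ⟨j, by omega⟩) ?_ ?_
    · rw [superFrame_mk_left, superFrame_mk_left, hij]
    · simpa [Fin.ext_iff] using hne

end SuperFrame

section OrientedHyperplane
variable {m : ℕ}

theorem stdFrame_eq_basis (n : ℕ) :
    stdFrame n = ⇑(EuclideanSpace.basisFun (Fin n) ℝ).toBasis := by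
  funext i
  simp [stdFrame]

theorem inner_hyperplaneFrame {v : RSpace (m + 1)} (hv : v ≠ 0) (i : Fin m) :
    inner ℝ v (hyperplaneFrame v hv i) = 0 := by
  have : Fact (Module.finrank ℝ (RSpace (m + 1)) = m + 1) := ⟨finrank_euclideanSpace_fin⟩
  exact Submodule.mem_orthogonal_singleton_iff_inner_right.1
    (OrthonormalBasis.fromOrthogonalSpanSingleton (𝕜 := ℝ) m hv i).2

theorem orthonormal_hyperplaneFrame {v : RSpace (m + 1)} (hv : v ≠ 0) :
    Orthonormal ℝ (hyperplaneFrame v hv) := by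
  have : Fact (Module.finrank ℝ (RSpace (m + 1)) = m + 1) := ⟨finrank_euclideanSpace_fin⟩
  exact (OrthonormalBasis.fromOrthogonalSpanSingleton (𝕜 := ℝ) m hv).orthonormal.comp_linearIsometry
    (Submodule.subtypeₗᵢ _)

/-- The frame `(v / ‖v‖, e₁, …, e_m)` is orthonormal, hence has determinant `± 1`. -/
theorem abs_det_cons_hyperplaneFrame {v : RSpace (m + 1)} (hv : v ≠ 0) :
    |(EuclideanSpace.basisFun (Fin (m + 1)) ℝ).toBasis.det (Fin.cons v (hyperplaneFrame v hv))| =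
      ‖v‖ := by
  have hn : ‖v‖ ≠ 0 := norm_ne_zero_iff.2 hv
  set f : Fin (m + 1) → RSpace (m + 1) := Fin.cons (‖v‖⁻¹ • v) (hyperplaneFrame v hv) with hf
  have hon : Orthonormal ℝ f := by
    have hE := orthonormal_iff_ite.1 (orthonormal_hyperplaneFrame hv)
    rw [orthonormal_iff_ite]
    intro i j
    refine Fin.cases ?_ (fun i => ?_) i <;> refine Fin.cases ?_ (fun j => ?_) j
    · simp [hf, norm_smul, hn]
    · simp [hf, inner_smul_left, inner_hyperplaneFrame, (Fin.succ_ne_zero j).symm]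
    · simp [hf, inner_smul_right, real_inner_comm, inner_hyperplaneFrame, Fin.succ_ne_zero i]
    · simpa [hf] using hE i j
  have hcard : Fintype.card (Fin (m + 1)) = Module.finrank ℝ (RSpace (m + 1)) := by simp
  set b : OrthonormalBasis (Fin (m + 1)) ℝ (RSpace (m + 1)) :=
    (basisOfOrthonormalOfCardEqFinrank hon hcard).toOrthonormalBasis (by simpa using hon) with hb
  have hbf : ⇑b = f := by simp [hb]
  have hdet := (EuclideanSpace.basisFun (Fin (m + 1)) ℝ).det_to_matrix_orthonormalBasis_real b
  have hdetf : |(EuclideanSpace.basisFun (Fin (m + 1)) ℝ).toBasis.det f| = 1 := by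
    rw [← hbf]
    rcases hdet with h | h <;> rw [h] <;> simp
  have hcons : (Fin.cons v (hyperplaneFrame v hv) : Fin (m + 1) → RSpace (m + 1)) =
      Function.update f 0 (‖v‖ • f 0) := by
    rw [hf, Fin.update_cons_zero, Fin.cons_zero, smul_inv_smul₀ hn]
  rw [hcons, AlternatingMap.map_update_smul, Function.update_eq_self, smul_eq_mul, abs_mul, hdetf,
    abs_norm, mul_one]

/-- The value of an `m`-form on a positive orthonormal basis of the hyperplane orthogonal to `v`, in
terms of its values on the standard frame. -/
theorem orientationSign_mul_apply_hyperplaneFrame {v : RSpace (m + 1)} (hv : v ≠ 0)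
    (β : RSpace (m + 1) [⋀^Fin m]→ₗ[ℝ] ℝ) :
    orientationSign v (hyperplaneFrame v hv) * β (hyperplaneFrame v hv) =
      ∑ i : Fin (m + 1), (-1 : ℝ) ^ (i : ℕ) *
        (inner ℝ v (stdFrame (m + 1) i) / ‖v‖ * β (i.removeNth (stdFrame (m + 1)))) := by
  have hn : ‖v‖ ≠ 0 := norm_ne_zero_iff.2 hv
  -- Evaluate the top-degree form `v* ∧ β` on the two frames.
  set Ω := AlternatingMap.alternatizeUncurryFin
    ((innerSL ℝ v).toLinearMap.smulRight β) with hΩ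
  have hΩa : ∀ w : Fin (m + 1) → RSpace (m + 1),
      Ω w = ∑ i : Fin (m + 1), (-1 : ℝ) ^ (i : ℕ) * (inner ℝ v (w i) * β (i.removeNth w)) := by
    intro w
    rw [hΩ, AlternatingMap.alternatizeUncurryFin_apply]
    refine Finset.sum_congr rfl fun i _ => ?_
    simp
  have h1 : Ω (Fin.cons v (hyperplaneFrame v hv)) = ‖v‖ ^ 2 * β (hyperplaneFrame v hv) := by
    rw [hΩa, Fin.sum_univ_succ]
    simp [inner_hyperplaneFrame]
  set D := (EuclideanSpace.basisFun (Fin (m + 1)) ℝ).toBasis.det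
    (Fin.cons v (hyperplaneFrame v hv)) with hD
  have h2 : Ω (Fin.cons v (hyperplaneFrame v hv)) = Ω (stdFrame (m + 1)) * D := by
    conv_lhs => rw [AlternatingMap.eq_smul_basis_det
      (EuclideanSpace.basisFun (Fin (m + 1)) ℝ).toBasis Ω]
    rw [stdFrame_eq_basis]
    rfl
  have h3 : orientationSign v (hyperplaneFrame v hv) * D = ‖v‖ := by
    rw [← abs_det_cons_hyperplaneFrame hv, orientationSign, ← hD]
    exact sign_mul_self _
  have h4 : ∑ i : Fin (m + 1), (-1 : ℝ) ^ (i : ℕ) *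
      (inner ℝ v (stdFrame (m + 1) i) / ‖v‖ * β (i.removeNth (stdFrame (m + 1)))) =
      Ω (stdFrame (m + 1)) / ‖v‖ := by
    rw [hΩa, Finset.sum_div]
    exact Finset.sum_congr rfl fun i _ => by ring
  rw [h4, eq_div_iff hn]
  have h5 : ‖v‖ ^ 2 * β (hyperplaneFrame v hv) = Ω (stdFrame (m + 1)) * D := h1.symm.trans h2
  apply mul_left_cancel₀ hn
  calc _ = orientationSign v (hyperplaneFrame v hv) * (‖v‖ ^ 2 * β (hyperplaneFrame v hv)) := by
        ring
    _ = Ω (stdFrame (m + 1)) * (orientationSign v (hyperplaneFrame v hv) * D) := by rw [h5]; ring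
    _ = _ := by rw [h3]; ring

end OrientedHyperplane

/-! ### The currents of the formula on test forms -/

section Pairings
variable {m : ℕ}

/-- The coefficient of `dx_{≠ i} ∧ dξ_{≠ j}` in a test form of bidegree `(m, m)`. -/
noncomputable def coeffForm (α : TestForm (m + 1) (m + m) m m) (i j : Fin (m + 1)) :
    RSpace (m + 1) → ℝ :=
  evalAt α (superFrame rfl (i.removeNth (stdFrame (m + 1))) (j.removeNth (stdFrame (m + 1))))

/-- The coefficient of `dx₁ ∧ … ∧ dxₙ ∧ dξ₁ ∧ … ∧ dξₙ` in `d^# d α`, as a sum of signed second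
derivatives of the coefficients of `α`. -/
theorem evalAt_formDSharp_formD (α : TestForm (m + 1) (m + m) m m) (x : RSpace (m + 1))
    (h : m + m + 1 + 1 = (m + 1) + (m + 1)) :
    evalAt (formDSharp (m + 1) (m + m + 1) (m + 1) m (formD (m + 1) (m + m) m m α))
        (superFrame h (stdFrame (m + 1)) (stdFrame (m + 1))) x =
      ∑ j : Fin (m + 1), ∑ i : Fin (m + 1), (-1 : ℝ) ^ (m + 1 + j : ℕ) * (-1 : ℝ) ^ (i : ℕ) *
        fderiv ℝ (fun y => fderiv ℝ (coeffForm α i j) y (stdFrame (m + 1) i)) x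
          (stdFrame (m + 1) j) := by
  rw [evalAt_formDSharp, sum_superFrame_right h _ _ (fun z w => fderiv ℝ
    (evalAt (formD (m + 1) (m + m) m m α) w) x z.2) (fun y w => map_zero _)]
  refine Finset.sum_congr rfl fun j _ => ?_
  have hD : evalAt (formD (m + 1) (m + m) m m α) (superFrame (by omega) (stdFrame (m + 1))
      (j.removeNth (stdFrame (m + 1)))) = fun y => ∑ i : Fin (m + 1), (-1 : ℝ) ^ (i : ℕ) *
        fderiv ℝ (coeffForm α i j) y (stdFrame (m + 1) i) := by
    funext y
    rw [evalAt_formD, sum_superFrame_left (by omega) _ _ (fun z w => fderiv ℝ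
      (evalAt α w) y z.1) (fun y w => map_zero _)]
    rfl
  have hdiff : ∀ i, DifferentiableAt ℝ
      (fun y => fderiv ℝ (coeffForm α i j) y (stdFrame (m + 1) i)) x := fun i =>
    ((((contDiff_evalAt α _).fderiv_right (m := 1) (by norm_cast)).clm_apply
      contDiff_const).differentiable (by simp)).differentiableAt
  have hfd := HasFDerivAt.fun_sum (u := Finset.univ) fun (i : Fin (m + 1)) _ =>
    ((hdiff i).hasFDerivAt.const_mul ((-1 : ℝ) ^ (i : ℕ)))
  rw [hD]
  simp only [hfd.fderiv, sum_apply, smul_apply, smul_eq_mul, Finset.mul_sum, mul_assoc]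

/-- The density which `[V] ∧ J(v^*)` integrates over `V`, in terms of the coefficients of `α`. -/
theorem orientationSign_mul_evalAt_wedge {v : RSpace (m + 1)} (hv : v ≠ 0)
    (α : TestForm (m + 1) (m + m) m m) (x : RSpace (m + 1)) (h : m + m + 1 = m + (m + 1)) :
    orientationSign v (hyperplaneFrame v hv) * evalAt (TestFunction.postcompCLM
        (wedgePoint (m + 1) (m + m) m m (normalFormJ v) (normalFormJ_left v)) α)
        (superFrame h (hyperplaneFrame v hv) (stdFrame (m + 1))) x =
      ∑ j : Fin (m + 1), ∑ i : Fin (m + 1), (-1 : ℝ) ^ (m + j : ℕ) * (-1 : ℝ) ^ (i : ℕ) *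
        (inner ℝ v (stdFrame (m + 1) j) * inner ℝ v (stdFrame (m + 1) i) / ‖v‖) *
          coeffForm α i j x := by
  rw [evalAt_wedge, sum_superFrame_right h _ _ (fun z w => normalFormJ v z * evalAt α w x)
    (fun y w => by rw [normalFormJ_left, zero_mul]), Finset.mul_sum]
  refine Finset.sum_congr rfl fun j _ => ?_
  have h1 : normalFormJ v (0, stdFrame (m + 1) j) = inner ℝ v (stdFrame (m + 1) j) := by
    simp [normalFormJ, normalForm, swapJ]
  have h2 := orientationSign_mul_apply_hyperplaneFrame hv (partialForm rfl
    (BiForm.incl (m + 1) (m + m) m m (α x)) (j.removeNth (stdFrame (m + 1))))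
  have h3 : ∀ e : Fin m → RSpace (m + 1), partialForm rfl
      (BiForm.incl (m + 1) (m + m) m m (α x)) (j.removeNth (stdFrame (m + 1))) e =
      evalAt α (superFrame rfl e (j.removeNth (stdFrame (m + 1)))) x := fun e => rfl
  simp only [h3] at h2
  rw [h1]
  calc _ = (-1 : ℝ) ^ (m + j : ℕ) * inner ℝ v (stdFrame (m + 1) j) *
      (orientationSign v (hyperplaneFrame v hv) * evalAt α (superFrame rfl (hyperplaneFrame v hv)
        (j.removeNth (stdFrame (m + 1)))) x) := by ring
    _ = _ := by
      rw [h2, Finset.mul_sum]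
      refine Finset.sum_congr rfl fun i _ => ?_
      rw [coeffForm]
      ring

theorem functionCurrent_apply {k n : ℕ} (h : k = n + n) {f : RSpace n → ℝ} (hf : Continuous f)
    (β : TestForm n k n n) : functionCurrent h f β =
      ∫ x, f x * evalAt β (superFrame h (stdFrame n) (stdFrame n)) x := by
  rw [functionCurrent, ContinuousLinearMap.comp_apply,
    TestFunction.integralAgainstBilinCLM_eq_integral (hf.locallyIntegrable.locallyIntegrableOn _)]
  refine integral_congr_ae (Eventually.of_forall fun x => ?_)
  exact mul_comm _ _

theorem integrationCurrent_apply {k : ℕ} (h : k = m + (m + 1)) {v : RSpace (m + 1)} (hv : v ≠ 0)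
    {V : Set (RSpace (m + 1))} (hV : LocallyIntegrable (fun _ : RSpace (m + 1) => (1 : ℝ))
      ((μHE[m] : Measure (RSpace (m + 1))).restrict V)) (β : TestForm (m + 1) k m (m + 1)) :
    integrationCurrent h v hv V β = ∫ x in V, orientationSign v (hyperplaneFrame v hv) *
      evalAt β (superFrame h (hyperplaneFrame v hv) (stdFrame (m + 1))) x ∂μHE[m] := by
  rw [integrationCurrent, smul_apply, ContinuousLinearMap.comp_apply,
    TestFunction.integralAgainstBilinCLM_eq_integral (hV.locallyIntegrableOn _), smul_eq_mul,
    ← integral_const_mul]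
  refine integral_congr_ae (Eventually.of_forall fun x => ?_)
  exact congrArg _ (mul_one _)

end Pairings

theorem mainTheorem7 (m : ℕ) (A : Finset (Fin (m + 1) → ℤ)) (hA : A.Nonempty)
    (ν : (Fin (m + 1) → ℤ) → ℝ) {ι : Type*} [Fintype ι] (a b : ι → Fin (m + 1) → ℤ)
    (hF : IsFacetList A hA ν a b) :
    (SuperCurrent.d (SuperCurrent.dSharp
        (functionCurrent (k := m + m + 1 + 1) (by omega) (tropPoly A hA ν))) :
      SuperCurrent (m + 1) (m + m) m m) =
      ∑ i, SuperCurrent.wedge (integrationCurrent (k := m + m + 1) (by omega) (facetNormal (a i) (b i))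
          (hF.isFacetPair i).normal_ne_zero (tropFacet A hA ν (a i) (b i)))
        (normalFormJ (facetNormal (a i) (b i))) (normalFormJ_left _) := by
  ext α
  have hcs : ∀ i j, HasCompactSupport (coeffForm α i j) := fun i j => hasCompactSupport_evalAt α _
  have hcd : ∀ i j, ContDiff ℝ ∞ (coeffForm α i j) := fun i j => contDiff_evalAt α _
  have hlhs : SuperCurrent.d (SuperCurrent.dSharp
        (functionCurrent (k := m + m + 1 + 1) (by omega) (tropPoly A hA ν))) α =
      ∑ j : Fin (m + 1), ∑ i : Fin (m + 1), (-1 : ℝ) ^ (m + j : ℕ) * (-1 : ℝ) ^ (i : ℕ) *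
        ∫ x, tropPoly A hA ν x * fderiv ℝ
          (fun y => fderiv ℝ (coeffForm α i j) y (stdFrame (m + 1) i)) x (stdFrame (m + 1) j) := by
    have hint : ∀ i j, Integrable fun x => tropPoly A hA ν x * fderiv ℝ
        (fun y => fderiv ℝ (coeffForm α i j) y (stdFrame (m + 1) i)) x (stdFrame (m + 1) j) := by
      intro i j
      have h1 : ContDiff ℝ 1 fun y => fderiv ℝ (coeffForm α i j) y (stdFrame (m + 1) i) :=
        ((hcd i j).fderiv_right (m := 1) (by norm_cast)).clm_apply contDiff_const
      have h2 : HasCompactSupport fun y => fderiv ℝ (coeffForm α i j) y (stdFrame (m + 1) i) :=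
        ((hcs i j).fderiv (𝕜 := ℝ)).comp_left
          (g := fun A : RSpace (m + 1) →L[ℝ] ℝ => A (stdFrame (m + 1) i)) (by simp)
      refine Continuous.integrable_of_hasCompactSupport (continuous_tropPoly.mul
        ((h1.continuous_fderiv (by simp)).clm_apply continuous_const))
        (HasCompactSupport.mul_left ?_)
      exact (h2.fderiv (𝕜 := ℝ)).comp_left
          (g := fun A : RSpace (m + 1) →L[ℝ] ℝ => A (stdFrame (m + 1) j)) (by simp)
    have e1 : SuperCurrent.d (SuperCurrent.dSharp
        (functionCurrent (k := m + m + 1 + 1) (by omega) (tropPoly A hA ν))) α =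
        (-1 : ℝ) ^ (m + m) * ((-1 : ℝ) ^ (m + m + 1) * functionCurrent (by omega)
          (tropPoly A hA ν) (formDSharp (m + 1) (m + m + 1) (m + 1) m
            (formD (m + 1) (m + m) m m α))) := rfl
    -- The signs from `d` and `d^#` combine to `-1`.
    have e2 : ∀ r : ℝ, (-1 : ℝ) ^ (m + m) * ((-1 : ℝ) ^ (m + m + 1) * r) = -1 * r := by
      intro r
      rw [pow_succ, ← two_mul, pow_mul]
      simp
    rw [e1, e2, functionCurrent_apply _ continuous_tropPoly, ← integral_const_mul]
    simp_rw [evalAt_formDSharp_formD, Finset.mul_sum]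
    rw [integral_finsetSum]
    · refine Finset.sum_congr rfl fun j _ => ?_
      rw [integral_finsetSum]
      · refine Finset.sum_congr rfl fun i _ => ?_
        rw [← integral_const_mul]
        refine integral_congr_ae (Eventually.of_forall fun x => ?_)
        simp only [pow_add, pow_one]
        ring
      · intro i _
        refine ((hint i j).const_mul (-1 * ((-1 : ℝ) ^ (m + 1 + j : ℕ) * (-1 : ℝ) ^ (i : ℕ)))).congr
          (Eventually.of_forall fun x => ?_)
        ring
    · intro j _
      refine integrable_finsetSum _ fun i _ => ?_
      refine ((hint i j).const_mul (-1 * ((-1 : ℝ) ^ (m + 1 + j : ℕ) * (-1 : ℝ) ^ (i : ℕ)))).congr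
        (Eventually.of_forall fun x => ?_)
      ring
  rw [hlhs, sum_apply]
  simp_rw [integral_tropPoly_mul_fderiv_fderiv hF ((hcd _ _).of_le (by norm_cast)) (hcs _ _),
    Finset.mul_sum]
  simp_rw [Finset.sum_comm (s := (Finset.univ : Finset (Fin (m + 1))))
    (t := (Finset.univ : Finset ι))]
  refine Finset.sum_congr rfl fun l _ => ?_
  have hloc := (hF.isFacetPair l).locallyIntegrable_one
  have hint : ∀ i j, IntegrableOn (coeffForm α i j) (tropFacet A hA ν (a l) (b l)) μHE[m] := by
    intro i j
    have := (hloc.integrable_smul_right_of_hasCompactSupport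
      (hcd i j).continuous (hcs i j))
    simpa [IntegrableOn] using this
  have hrhs : SuperCurrent.wedge (integrationCurrent (k := m + m + 1) (by omega)
      (facetNormal (a l) (b l)) (hF.isFacetPair l).normal_ne_zero (tropFacet A hA ν (a l) (b l)))
        (normalFormJ (facetNormal (a l) (b l))) (normalFormJ_left _) α =
      integrationCurrent (by omega) (facetNormal (a l) (b l)) (hF.isFacetPair l).normal_ne_zero
        (tropFacet A hA ν (a l) (b l)) (TestFunction.postcompCLM
        (wedgePoint (m + 1) (m + m) m m (normalFormJ (facetNormal (a l) (b l)))
          (normalFormJ_left _)) α) := rfl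
  rw [hrhs, integrationCurrent_apply _ _ hloc]
  simp_rw [orientationSign_mul_evalAt_wedge]
  rw [integral_finsetSum]
  · refine Finset.sum_congr rfl fun j _ => ?_
    rw [integral_finsetSum]
    · refine Finset.sum_congr rfl fun i _ => ?_
      rw [integral_const_mul]
      ring
    · exact fun i _ => (hint i j).const_mul _
  · exact fun j _ => integrable_finsetSum _ fun i _ => (hint i j).const_mul _
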